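/- Let $(X,\mu)$ be a standard probability space. An automorphism of $(X,\mu)$ is an invertible bimeasurable $\mu$-preserving map $X\to X$, considered modulo null sets; for an automorphism $T$ write $T$ also for the operator on $L_2(X,\mu)$ given by $Tf(x)=f(Tx)$. The weakly homoclinic group of $T$ is $$WH(T)=\Bigl\{S\in \mathrm{Aut}(\mu):\ \frac1N\sum_{i=1}^{N}T^{-i}ST^{i}\to I\ \text{ strongly as } N\to\infty\Bigr\}.$$ $T$ has rank $1$ if there is a sequence of measurable partitions $\xi_j=\{E_j,TE_j,\dots,T^{h_j-1}E_j,\tilde E_j\}$ of $X$, with $h_j\ge 1$, such that for every measurable set $A$ and every $\varepsilon>0$, for all sufficiently large $j$ there is a union $B$ of cells of $\xi_j$ with $\mu(A\,\triangle\,B)<\varepsilon$. An automorphism $S$ is aperiodic if for almost every $x$ one has $S^nx\ne x$ for all $n\ge1$. A Markov operator is a bounded operator $P$ on $L_2(X,\mu)$ that maps non-negative functions to non-negative functions and satisfies $P1=1$ and $P^*1=1$. **Theorem.** Let $T$ be an automorphism of $(X,\mu)$ of rank $1$. 1. If $WH(T)$ contains an aperiodic automorphism, then $T$ is rigid: there is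 a sequence of positive integers $m(j)\to\infty$ with $T^{m(j)}\to I$ strongly. 2. If $WH(T)$ is nontrivial, i.e. $WH(T)\neq\{I\}$, then $T$ is partially rigid with exponent $\frac12$: there are a sequence of positive integers $m(i)\to\infty$ and a Markov operator $P$ with $$T^{m(i)}\to \tfrac12 I+\tfrac12 P$$ in the weak operator topology. -/

import Mathlib

open MeasureTheory Filter Topology
open scoped InnerProductSpace symmDiff

namespace ErgodicWH

variable {X : Type*} [MeasurableSpace X]

/-- An automorphism of the measure space `(X, μ)`: an invertible bimeasurable map that
preserves `μ`. -/
structure Automorphism (μ : Measure X) where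
  /-- the underlying bimeasurable bijection -/
  toEquiv : X ≃ᵐ X
  measurePreserving : MeasurePreserving toEquiv μ μ

variable {μ : Measure X}

/-- The inverse automorphism. -/
def Automorphism.symm (T : Automorphism μ) : Automorphism μ where
  toEquiv := T.toEquiv.symm
  measurePreserving := T.measurePreserving.symm T.toEquiv

/-- The operator on `L₂(X, μ)` that corresponds to `T`, given by `(T f)(x) = f (T x)`. -/
noncomputable def Automorphism.koopman (T : Automorphism μ) : Lp ℝ 2 μ →L[ℝ] Lp ℝ 2 μ :=
  (Lp.compMeasurePreservingₗᵢ ℝ T.toEquiv T.measurePreserving).toContinuousLinearMap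

/-- The weakly homoclinic group `WH(T)`: the automorphisms `S` such that
`(1 / N) ∑_{i = 1}^{N} T⁻ⁱ S Tⁱ → I` in the strong operator topology of `L₂(X, μ)`. -/
def weaklyHomoclinic (T : Automorphism μ) : Set (Automorphism μ) :=
  {S | ∀ f : Lp ℝ 2 μ,
    Tendsto
      (fun N : ℕ => (1 / (N : ℝ)) •
        ∑ i ∈ Finset.Icc 1 N, (T.symm.koopman ^ i * S.koopman * T.koopman ^ i) f)
      atTop (𝓝 f)}

/-- The cells of the partition `{E, T E, …, T^(h-1) E, Ẽ}`: `some i` is the level `T^i E`, and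
`none` is the remainder `Ẽ`, the complement of the union of the levels. -/
def towerCell (T : X → X) (E : Set X) (h : ℕ) : Option (Fin h) → Set X
  | some i => T^[(i : ℕ)] '' E
  | none => (⋃ i : Fin h, T^[(i : ℕ)] '' E)ᶜ

/-- `T` has rank one: there are measurable partitions
`ξ_j = {E_j, T E_j, …, T^(h_j - 1) E_j, Ẽ_j}` such that every measurable set is approximated with
any prescribed accuracy by `ξ_j`-measurable sets (unions of cells of `ξ_j`) for all large `j`. -/
def Automorphism.IsRankOne (T : Automorphism μ) : Prop :=
  ∃ (E : ℕ → Set X) (h : ℕ → ℕ),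
    (∀ j, MeasurableSet (E j)) ∧ (∀ j, 0 < h j) ∧
    (∀ j, Pairwise fun a b : Fin (h j) =>
      Disjoint (T.toEquiv^[(a : ℕ)] '' E j) (T.toEquiv^[(b : ℕ)] '' E j)) ∧
    ∀ A : Set X, MeasurableSet A → ∀ ε : ENNReal, 0 < ε →
      ∀ᶠ j in atTop, ∃ s : Set (Option (Fin (h j))),
        μ (A ∆ ⋃ c ∈ s, towerCell T.toEquiv (E j) (h j) c) < ε

/-- Almost every point is non-periodic. -/
def Automorphism.IsAperiodic (S : Automorphism μ) : Prop :=
  ∀ᵐ x ∂μ, ∀ n : ℕ, 0 < n → S.toEquiv^[n] x ≠ x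

/-- `S` is the identity automorphism (automorphisms are considered modulo null sets). -/
def Automorphism.IsTrivial (S : Automorphism μ) : Prop :=
  ∀ᵐ x ∂μ, S.toEquiv x = x

/-- `T` is rigid: `T^{m(j)} → I` strongly for some sequence `m(j) → ∞`. -/
def Automorphism.IsRigid (T : Automorphism μ) : Prop :=
  ∃ m : ℕ → ℕ, Tendsto m atTop atTop ∧
    ∀ f : Lp ℝ 2 μ, Tendsto (fun j => (T.koopman ^ m j) f) atTop (𝓝 f)

/-- A Markov operator on `L₂(X, μ)`: positive, with `P 1 = 1` and `P* 1 = 1`. -/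
structure IsMarkovOperator [IsFiniteMeasure μ] (P : Lp ℝ 2 μ →L[ℝ] Lp ℝ 2 μ) : Prop where
  nonneg : ∀ f : Lp ℝ 2 μ, 0 ≤ f → 0 ≤ P f
  map_one : P (Lp.const 2 μ (1 : ℝ)) = Lp.const 2 μ (1 : ℝ)
  adjoint_map_one :
    ContinuousLinearMap.adjoint P (Lp.const 2 μ (1 : ℝ)) = Lp.const 2 μ (1 : ℝ)

/-- `T` is partially rigid with exponent `ρ`: `T^{m(i)} → ρ I + (1 - ρ) P` in the weak operator
topology of `L₂(X, μ)` for some sequence `m(i) → ∞` and some Markov operator `P`. -/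
def Automorphism.IsPartiallyRigid [IsFiniteMeasure μ] (T : Automorphism μ) (ρ : ℝ) : Prop :=
  ∃ (m : ℕ → ℕ) (P : Lp ℝ 2 μ →L[ℝ] Lp ℝ 2 μ),
    Tendsto m atTop atTop ∧ IsMarkovOperator P ∧
    ∀ f g : Lp ℝ 2 μ,
      Tendsto (fun i => ⟪(T.koopman ^ m i) f, g⟫_ℝ) atTop (𝓝 ⟪ρ • f + (1 - ρ) • P f, g⟫_ℝ)

end ErgodicWH

namespace ErgodicWH

/-! ### Koopman operators: from return times of sets to limits of operator powers. -/

section Koopman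

variable {X : Type*} [MeasurableSpace X] {μ : Measure X}

/-! Testing weak homoclinicity of S on indicators shows that, for most points y and most times i,
the points T^i y and T^i S y lie on the same side of any given set A; this passes to the iterates of
S (`AsympFixed`). Suppose that at some time y and Sy sit on levels a and b of a tall tower. They
then climb in parallel at distance k = |a - b|. Replacing A by a union B of levels, few
disagreements mean that level i lies in B exactly when level i + k does, for most i above min(a, b)
and below h - k. So A is almost T^k-invariant on that strip. Moreover k > 0 for most y with Sy ≠ y,
because levels eventually separate y from Sy. This is `IsRankOneSeq.eventually_exists_exceptional`.

For part 1 the strip must be nearly the whole tower, so a and b must both be near the bottom. The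
bottom 1/K of the tower has measure about 1/K, so recurrence of S returns some of its points to it
under some S^m with 0 < m < 2K, and aperiodicity gives S^m x ≠ x. Hence T has approximate periods on
every finite family of sets, which yields rigidity.

For part 2 take a point y near the bottom that S moves. If Sy is in the lower half, then k is at
most about h/2 at once. Otherwise wait until Sy has left through the top and re-entered at the
bottom; y has then climbed less than half the tower (`exists_time_of_strip`). Either way A is almost
T^k-invariant on roughly the lower half, which carries about half of A by equidistribution
(`IsRankOneSeq.eventually_equidistributed`). Thus A returns at time k with at least about half of
its mass. A weak limit R of such powers satisfies ⟨R 1_A, 1_B⟩ ≥ μ(A ∩ B)/2, so 2R - I is Markov.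

Two degenerate cases are separate: heights that do not tend to infinity force approximate periods by
pigeonhole, and the towers may miss one atom, which every automorphism fixes. -/

lemma Automorphism.koopman_apply (T : Automorphism μ) (f : Lp ℝ 2 μ) :
    T.koopman f = Lp.compMeasurePreserving T.toEquiv T.measurePreserving f := rfl

lemma Automorphism.koopman_pow_apply (T : Automorphism μ) (n : ℕ) (f : Lp ℝ 2 μ) :
    (T.koopman ^ n) f =
      Lp.compMeasurePreserving T.toEquiv^[n] (T.measurePreserving.iterate n) f := by
  rw [← Lp.compMeasurePreserving_iterate T.measurePreserving, FunLike.coe_pow_eq_iterate]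
  rfl

lemma Automorphism.norm_koopman_pow_apply (T : Automorphism μ) (n : ℕ) (f : Lp ℝ 2 μ) :
    ‖(T.koopman ^ n) f‖ = ‖f‖ := by
  rw [T.koopman_pow_apply, Lp.norm_compMeasurePreserving]

lemma Automorphism.measureReal_preimage_iterate (T : Automorphism μ) (n : ℕ) {A : Set X}
    (hA : MeasurableSet A) : μ.real (T.toEquiv^[n] ⁻¹' A) = μ.real A :=
  (T.measurePreserving.iterate n).measureReal_preimage hA.nullMeasurableSet

lemma Automorphism.measurableSet_preimage_iterate (T : Automorphism μ) (n : ℕ) {A : Set X}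
    (hA : MeasurableSet A) : MeasurableSet (T.toEquiv^[n] ⁻¹' A) :=
  hA.preimage (T.measurePreserving.iterate n).measurable

lemma Automorphism.lipschitzWith_koopman_pow (T : Automorphism μ) (n : ℕ) :
    LipschitzWith 1 (T.koopman ^ n) :=
  LipschitzWith.of_dist_le_mul fun f g => by
    rw [dist_eq_norm, ← map_sub, T.norm_koopman_pow_apply, dist_eq_norm]; simp

lemma Automorphism.isClosed_setOf_tendsto_koopman_pow {ι : Type*} {L : Filter ι}
    (T : Automorphism μ) (m : ι → ℕ) :
    IsClosed {f : Lp ℝ 2 μ | Tendsto (fun i => (T.koopman ^ m i) f) L (𝓝 f)} :=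
  (LipschitzWith.uniformEquicontinuous (fun i => ⇑(T.koopman ^ m i)) 1
    fun i => T.lipschitzWith_koopman_pow (m i)).equicontinuous.isClosed_setOfPred_tendsto
      continuous_id

lemma Automorphism.isClosed_setOf_tendsto_inner_koopman_pow {ι : Type*} {L : Filter ι}
    (T : Automorphism μ) (m : ι → ℕ) (R : Lp ℝ 2 μ →L[ℝ] Lp ℝ 2 μ) (g : Lp ℝ 2 μ) :
    IsClosed {f : Lp ℝ 2 μ |
      Tendsto (fun i => ⟪(T.koopman ^ m i) f, g⟫_ℝ) L (𝓝 ⟪R f, g⟫_ℝ)} := by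
  refine ((LipschitzWith.uniformEquicontinuous (fun i f => ⟪(T.koopman ^ m i) f, g⟫_ℝ) ‖g‖₊
    fun i => LipschitzWith.of_dist_le_mul fun f f' => ?_).equicontinuous.isClosed_setOfPred_tendsto
      (by fun_prop))
  rw [Real.dist_eq, ← inner_sub_left, ← map_sub]
  refine (abs_real_inner_le_norm _ _).trans ?_
  rw [T.norm_koopman_pow_apply, dist_eq_norm, mul_comm]
  rfl

variable [IsFiniteMeasure μ]

/-- The indicator function of a measurable set, as an element of `L²`. -/
noncomputable def ind (μ : Measure X) [IsFiniteMeasure μ] {A : Set X} (hA : MeasurableSet A) :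
    Lp ℝ 2 μ :=
  indicatorConstLp 2 hA (measure_ne_top μ A) 1

lemma compMeasurePreserving_ind {A : Set X} (hA : MeasurableSet A) {R : X → X}
    (hR : MeasurePreserving R μ μ) :
    Lp.compMeasurePreserving R hR (ind μ hA) = ind μ (hA.preimage hR.measurable) := rfl

lemma Automorphism.koopman_pow_ind (T : Automorphism μ) (n : ℕ) {A : Set X}
    (hA : MeasurableSet A) :
    (T.koopman ^ n) (ind μ hA) =
      ind μ (hA.preimage (T.measurePreserving.iterate n).measurable) := by
  rw [T.koopman_pow_apply, compMeasurePreserving_ind]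

lemma inner_ind_ind {A B : Set X} (hA : MeasurableSet A) (hB : MeasurableSet B) :
    ⟪ind μ hA, ind μ hB⟫_ℝ = μ.real (A ∩ B) := by
  simp [ind, L2.inner_indicatorConstLp_indicatorConstLp]

lemma const_one_eq_ind : Lp.const 2 μ (1 : ℝ) = ind μ MeasurableSet.univ :=
  indicatorConstLp_univ 2 μ (1 : ℝ) |>.symm

lemma simpleFunc_indicatorConst_eq_smul_ind (c : ℝ) {A : Set X} (hA : MeasurableSet A)
    (hμA : μ A ≠ ⊤) :
    (Lp.simpleFunc.indicatorConst 2 hA hμA c : Lp ℝ 2 μ) = c • ind μ hA := by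
  rw [Lp.simpleFunc.coe_indicatorConst]
  ext1
  filter_upwards [indicatorConstLp_coeFn (p := 2) (hs := hA) (hμs := hμA) (c := c),
    Lp.coeFn_smul c (ind μ hA),
    indicatorConstLp_coeFn (p := 2) (hs := hA) (hμs := measure_ne_top μ A) (c := (1 : ℝ))]
    with x h1 h2 h3
  rw [h1, h2, Pi.smul_apply, ind, h3]
  by_cases hx : x ∈ A <;> simp [hx]

lemma measureReal_symmDiff_eq_sub {A B : Set X} (hA : MeasurableSet A) (hB : MeasurableSet B) :
    μ.real (A ∆ B) = μ.real A + μ.real B - 2 * μ.real (A ∩ B) := by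
  have h1 := measureReal_inter_add_sdiff (μ := μ) (s := A) hB
  have h2 := measureReal_inter_add_sdiff (μ := μ) (s := B) hA
  rw [Set.inter_comm] at h2
  rw [measureReal_symmDiff_eq hA hB]
  linarith

/-- `T` has arbitrarily good approximate periods on every finite family of sets. -/
def Automorphism.ApproxPeriodic (T : Automorphism μ) : Prop :=
  ∀ 𝒜 : Finset (Set X), (∀ A ∈ 𝒜, MeasurableSet A) → ∀ ε : ℝ, 0 < ε →
    ∃ k : ℕ, 0 < k ∧ ∀ A ∈ 𝒜, μ.real (A ∆ (T.toEquiv^[k] ⁻¹' A)) ≤ ε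

/-- `T` has arbitrarily large times at which every set of a given finite family returns to itself
with probability almost `1 / 2`. -/
def Automorphism.HalfReturning (T : Automorphism μ) : Prop :=
  ∀ 𝒜 : Finset (Set X), (∀ A ∈ 𝒜, MeasurableSet A) → ∀ ε : ℝ, 0 < ε → ∀ M : ℕ,
    ∃ m : ℕ, M ≤ m ∧ ∀ A ∈ 𝒜, μ.real A / 2 - ε ≤ μ.real (A ∩ T.toEquiv^[m] ⁻¹' A)

lemma measureReal_symmDiff_preimage_iterate_le {R : X → X} (hR : MeasurePreserving R μ μ)
    {A : Set X} (hA : MeasurableSet A) (n : ℕ) :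
    μ.real (A ∆ (R^[n] ⁻¹' A)) ≤ n * μ.real (A ∆ (R ⁻¹' A)) := by
  have h := hR.measure_symmDiff_preimage_iterate_le hA.nullMeasurableSet n
  have h' := ENNReal.toReal_mono
    (by rw [nsmul_eq_mul]; exact ENNReal.mul_ne_top (by simp) (measure_ne_top _ _)) h
  simpa [Measure.real] using h'

lemma Automorphism.ApproxPeriodic.exists_ge {T : Automorphism μ} (hT : T.ApproxPeriodic)
    (𝒜 : Finset (Set X)) (h𝒜 : ∀ A ∈ 𝒜, MeasurableSet A) {ε : ℝ} (hε : 0 < ε) (M : ℕ) :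
    ∃ m : ℕ, M ≤ m ∧ ∀ A ∈ 𝒜, μ.real (A ∆ (T.toEquiv^[m] ⁻¹' A)) ≤ ε := by
  -- The multiple k(M + 1) is at least M and multiplies the error by at most M + 1.
  obtain ⟨k, hk, h⟩ := hT 𝒜 h𝒜 (ε / (M + 1)) (by positivity)
  refine ⟨k * (M + 1), by nlinarith, fun A hA => ?_⟩
  rw [Function.iterate_mul]
  refine (measureReal_symmDiff_preimage_iterate_le (T.measurePreserving.iterate k)
    (h𝒜 A hA) (M + 1)).trans ?_
  calc ((M + 1 : ℕ) : ℝ) * μ.real (A ∆ (T.toEquiv^[k] ⁻¹' A))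
      ≤ (M + 1 : ℕ) * (ε / (M + 1)) := by gcongr; exact h A hA
    _ = ε := by push_cast; field_simp

lemma Automorphism.ApproxPeriodic.halfReturning {T : Automorphism μ} (hT : T.ApproxPeriodic) :
    T.HalfReturning := by
  intro 𝒜 h𝒜 ε hε M
  obtain ⟨m, hm, h⟩ := hT.exists_ge 𝒜 h𝒜 hε M
  refine ⟨m, hm, fun A hA => ?_⟩
  have h1 := h A hA
  rw [measureReal_symmDiff_eq_sub (h𝒜 A hA) (T.measurableSet_preimage_iterate m (h𝒜 A hA)),
    T.measureReal_preimage_iterate m (h𝒜 A hA)] at h1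
  have := measureReal_nonneg (μ := μ) (s := A)
  linarith

/-- A net of times that realises, in the limit, a property of finite families of sets. -/
lemma exists_net_of_forall_finset {p : Set X → ℝ → ℕ → Prop}
    (hp : ∀ A ε ε' m, ε ≤ ε' → p A ε m → p A ε' m)
    (h : ∀ 𝒜 : Finset (Set X), (∀ A ∈ 𝒜, MeasurableSet A) → ∀ ε : ℝ, 0 < ε → ∀ M : ℕ,
      ∃ m : ℕ, M ≤ m ∧ ∀ A ∈ 𝒜, p A ε m) :
    ∃ m : Finset {A : Set X // MeasurableSet A} × ℕ → ℕ, Tendsto m atTop atTop ∧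
      ∀ A, MeasurableSet A → ∀ ε : ℝ, 0 < ε → ∀ᶠ i in atTop, p A ε (m i) := by
  have h' : ∀ i : Finset {A : Set X // MeasurableSet A} × ℕ, ∃ m : ℕ, i.2 ≤ m ∧
      ∀ A ∈ i.1, p A (1 / (i.2 + 1)) m := by
    intro i
    obtain ⟨m, hm, hm'⟩ := h (i.1.map (Function.Embedding.subtype _))
      (by simp only [Finset.mem_map]; rintro _ ⟨A, -, rfl⟩; exact A.2)
      (1 / (i.2 + 1)) (by positivity) i.2
    exact ⟨m, hm, fun A hA => hm' _ (Finset.mem_map_of_mem _ hA)⟩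
  choose m hm hm' using h'
  refine ⟨m, tendsto_atTop_mono hm ?_, fun A hA ε hε => ?_⟩
  · rw [← prod_atTop_atTop_eq]
    exact tendsto_snd
  · obtain ⟨n, hn⟩ := exists_nat_one_div_lt hε
    filter_upwards [eventually_ge_atTop (({⟨A, hA⟩}, n) :
      Finset {A : Set X // MeasurableSet A} × ℕ)] with i hi
    refine hp _ _ _ _ ?_ (hm' i ⟨A, hA⟩ (hi.1 (Finset.mem_singleton_self _)))
    refine le_trans ?_ hn.le
    have : (n : ℝ) ≤ i.2 := by exact_mod_cast hi.2
    gcongr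

/-- Diagonal choice: the i-th time is taken from the net so as to serve the finitely many indices
numbered at most i. Separability of L² makes countably many conditions enough in the applications.
-/
lemma exists_seq_of_net {ι κ : Type*} [Countable κ] {L : Filter ι} [L.NeBot] {m : ι → ℕ}
    (hm : Tendsto m L atTop) {E : κ → Type*} [∀ n, PseudoMetricSpace (E n)]
    {φ : ∀ n, ℕ → E n} {y : ∀ n, E n}
    (h : ∀ n, Tendsto (fun i => φ n (m i)) L (𝓝 (y n))) :
    ∃ s : ℕ → ℕ, Tendsto s atTop atTop ∧ ∀ n, Tendsto (fun i => φ n (s i)) atTop (𝓝 (y n)) := by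
  obtain ⟨e, he⟩ := exists_injective_nat κ
  have h' : ∀ i : ℕ, ∃ k : ℕ, i ≤ k ∧ ∀ n, e n ≤ i → dist (φ n k) (y n) < 1 / (i + 1) := by
    intro i
    have hfin : {n | e n ≤ i}.Finite := (Set.finite_Iic i).preimage he.injOn
    have h1 : ∀ᶠ j in L, ∀ n ∈ {n | e n ≤ i}, dist (φ n (m j)) (y n) < 1 / (i + 1) :=
      (eventually_all_finite hfin).2 fun n _ => Metric.tendsto_nhds.1 (h n) _ (by positivity)
    obtain ⟨j, hj1, hj2⟩ := (h1.and (hm.eventually_ge_atTop i)).exists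
    exact ⟨m j, hj2, hj1⟩
  choose s hs hs' using h'
  refine ⟨s, tendsto_atTop_mono hs tendsto_id, fun n => ?_⟩
  rw [tendsto_iff_dist_tendsto_zero]
  refine squeeze_zero' (Eventually.of_forall fun _ => dist_nonneg) ?_
    tendsto_one_div_add_atTop_nhds_zero_nat
  filter_upwards [eventually_ge_atTop (e n)] with i hi
  exact (hs' i n hi).le

lemma isClosed_setOf_tendsto_inner {ι E : Type*} [NormedAddCommGroup E] [InnerProductSpace ℝ E]
    {L : Filter ι} {u : ι → E} {C : NNReal} (hu : ∀ i, ‖u i‖ ≤ C) (v : E) :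
    IsClosed {g : E | Tendsto (fun i => ⟪u i, g⟫_ℝ) L (𝓝 ⟪v, g⟫_ℝ)} := by
  refine ((LipschitzWith.uniformEquicontinuous (fun i g => ⟪u i, g⟫_ℝ) C
    fun i => LipschitzWith.of_dist_le_mul fun f f' => ?_).equicontinuous.isClosed_setOfPred_tendsto
      (by fun_prop))
  rw [Real.dist_eq, ← inner_sub_right, dist_eq_norm]
  exact (abs_real_inner_le_norm _ _).trans (by gcongr; exact hu i)

lemma norm_ind_sub_sq {A B : Set X} (hA : MeasurableSet A) (hB : MeasurableSet B) :
    ‖ind μ hB - ind μ hA‖ ^ 2 = μ.real (A ∆ B) := by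
  rw [@norm_sub_sq_real, ← real_inner_self_eq_norm_sq, ← real_inner_self_eq_norm_sq, inner_ind_ind,
    inner_ind_ind, inner_ind_ind, measureReal_symmDiff_eq_sub hA hB, Set.inter_self,
    Set.inter_self, Set.inter_comm]
  ring

/-- The squared distance between two indicators is the measure of the symmetric difference, so
approximate periods give strong convergence on indicators. It extends to L² because the powers of T
are isometries. -/
theorem Automorphism.ApproxPeriodic.isRigid [MeasurableSpace.CountablyGenerated X]
    {T : Automorphism μ} (hT : T.ApproxPeriodic) : T.IsRigid := by
  have : Fact ((2 : ENNReal) ≠ ⊤) := ⟨ENNReal.ofNat_ne_top⟩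
  obtain ⟨m, hm, h⟩ := exists_net_of_forall_finset
    (p := fun A ε m => μ.real (A ∆ (T.toEquiv^[m] ⁻¹' A)) ≤ ε)
    (fun A ε ε' m h1 h2 => h2.trans h1) fun 𝒜 h𝒜 ε hε M => hT.exists_ge 𝒜 h𝒜 hε M
  have key : ∀ f : Lp ℝ 2 μ, Tendsto (fun i => (T.koopman ^ m i) f) atTop (𝓝 f) := by
    intro f
    refine Lp.induction ENNReal.ofNat_ne_top
      (fun f : Lp ℝ 2 μ => Tendsto (fun i => (T.koopman ^ m i) f) atTop (𝓝 f)) ?_ ?_ ?_ f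
    · intro c A hA hμA
      rw [simpleFunc_indicatorConst_eq_smul_ind]
      simp_rw [map_smul]
      refine Tendsto.const_smul ?_ c
      rw [tendsto_iff_norm_sub_tendsto_zero]
      have h0 : Tendsto (fun i => ‖(T.koopman ^ m i) (ind μ hA) - ind μ hA‖ ^ 2) atTop (𝓝 0) := by
        simp_rw [T.koopman_pow_ind, norm_ind_sub_sq]
        refine tendsto_order.2 ⟨fun a ha => Eventually.of_forall fun i =>
          ha.trans_le measureReal_nonneg, fun a ha => ?_⟩
        filter_upwards [h A hA (a / 2) (by positivity)] with i hi
        linarith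
      simpa using h0.sqrt
    · intro f g hf hg _ h1 h2
      simp_rw [map_add]
      exact h1.add h2
    · exact T.isClosed_setOf_tendsto_koopman_pow m
  obtain ⟨s, hs, hs'⟩ := exists_seq_of_net (κ := ℕ) hm
    (φ := fun n k => (T.koopman ^ k) (TopologicalSpace.denseSeq (Lp ℝ 2 μ) n))
    fun n => key (TopologicalSpace.denseSeq (Lp ℝ 2 μ) n)
  refine ⟨s, hs, fun f => ?_⟩
  have hcl := T.isClosed_setOf_tendsto_koopman_pow (L := atTop) s
  have : closure (Set.range (TopologicalSpace.denseSeq (Lp ℝ 2 μ))) ⊆ _ :=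
    closure_minimal (Set.range_subset_iff.2 hs') hcl
  exact this (TopologicalSpace.denseRange_denseSeq _ f)

/-- Bounded operators have weak operator limits along ultrafilters. -/
lemma exists_weakLimit_of_ultrafilter {ι E : Type*} [NormedAddCommGroup E] [InnerProductSpace ℝ E]
    [CompleteSpace E] (U : Ultrafilter ι) (A : ι → E →L[ℝ] E) (hA : ∀ i f, ‖A i f‖ ≤ ‖f‖) :
    ∃ R : E →L[ℝ] E, ∀ f g, Tendsto (fun i => ⟪A i f, g⟫_ℝ) U (𝓝 ⟪R f, g⟫_ℝ) := by
  have hb : ∀ f g i, ⟪A i f, g⟫_ℝ ∈ Set.Icc (-(‖f‖ * ‖g‖)) (‖f‖ * ‖g‖) := fun f g i =>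
    abs_le.1 ((abs_real_inner_le_norm _ _).trans (by gcongr; exact hA i f))
  have hlim : ∀ f g, ∃ c ∈ Set.Icc (-(‖f‖ * ‖g‖)) (‖f‖ * ‖g‖),
      Tendsto (fun i => ⟪A i f, g⟫_ℝ) U (𝓝 c) := fun f g =>
    isCompact_Icc.ultrafilter_le_nhds (U.map fun i => ⟪A i f, g⟫_ℝ)
      (le_principal_iff.2 (Filter.mem_map.2 (Eventually.of_forall (hb f g))))
  choose b hb' hblim using hlim
  let B : E →ₗ[ℝ] E →ₗ[ℝ] ℝ := LinearMap.mk₂ ℝ b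
    (fun f f' g => tendsto_nhds_unique (hblim _ _) (by
      simpa only [map_add, inner_add_left] using (hblim f g).add (hblim f' g)))
    (fun c f g => tendsto_nhds_unique (hblim _ _) (by
      simpa only [map_smul, real_inner_smul_left, smul_eq_mul] using (hblim f g).const_mul c))
    (fun f g g' => tendsto_nhds_unique (hblim _ _) (by
      simpa only [inner_add_right] using (hblim f g).add (hblim f g')))
    (fun c f g => tendsto_nhds_unique (hblim _ _) (by
      simpa only [real_inner_smul_right, smul_eq_mul] using (hblim f g).const_mul c))
  refine ⟨InnerProductSpace.continuousLinearMapOfBilin (𝕜 := ℝ) (B.mkContinuous₂ 1 fun f g => ?_),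
    fun f g => ?_⟩
  · rw [one_mul]
    exact abs_le.2 (hb' f g)
  · rw [InnerProductSpace.continuousLinearMapOfBilin_apply]
    exact hblim f g

lemma nonneg_of_forall_inner_ind_nonneg {f : Lp ℝ 2 μ}
    (h : ∀ A (hA : MeasurableSet A), 0 ≤ ⟪f, ind μ hA⟫_ℝ) : 0 ≤ f := by
  rw [← Lp.coeFn_nonneg]
  refine ae_nonneg_of_forall_setIntegral_nonneg ((Lp.memLp f).integrable (by norm_num))
    fun A hA _ => ?_
  have := h A hA
  rwa [real_inner_comm, ind, L2.inner_indicatorConstLp_one] at this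

/-- An operator on `L²` is positive if it is so on indicator functions. -/
lemma map_nonneg_of_forall_inner_ind_nonneg {Q : Lp ℝ 2 μ →L[ℝ] Lp ℝ 2 μ}
    (h : ∀ A B (hA : MeasurableSet A) (hB : MeasurableSet B), 0 ≤ ⟪Q (ind μ hA), ind μ hB⟫_ℝ)
    {f : Lp ℝ 2 μ} (hf : 0 ≤ f) : 0 ≤ Q f := by
  -- The induction runs through functions of arbitrary sign, so positivity is proved for positive
  -- parts; these are additive on functions with disjoint supports.
  have key : 0 ≤ Q (Lp.posPart f) := by
    refine Lp.induction ENNReal.ofNat_ne_top (fun f : Lp ℝ 2 μ => 0 ≤ Q (Lp.posPart f)) ?_ ?_ ?_ f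
    · intro c A hA hμA
      have : Lp.posPart (Lp.simpleFunc.indicatorConst 2 hA hμA.ne c : Lp ℝ 2 μ) =
          max c 0 • ind μ hA := by
        rw [Lp.simpleFunc.coe_indicatorConst]
        ext1
        filter_upwards [Lp.coeFn_posPart (indicatorConstLp 2 hA hμA.ne c),
          indicatorConstLp_coeFn (p := 2) (hs := hA) (hμs := hμA.ne) (c := c),
          Lp.coeFn_smul (max c 0) (ind μ hA),
          indicatorConstLp_coeFn (p := 2) (hs := hA) (hμs := measure_ne_top μ A) (c := (1 : ℝ))]
          with x h1 h2 h3 h4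
        rw [h1, h2, h3, Pi.smul_apply, ind, h4]
        by_cases hx : x ∈ A <;> simp [hx]
      rw [this, map_smul]
      refine nonneg_of_forall_inner_ind_nonneg fun B hB => ?_
      rw [real_inner_smul_left]
      exact mul_nonneg (le_max_right _ _) (h A B hA hB)
    · intro f g hf hg hfg h1 h2
      have : Lp.posPart (hf.toLp f + hg.toLp g) =
          Lp.posPart (hf.toLp f) + Lp.posPart (hg.toLp g) := by
        ext1
        filter_upwards [Lp.coeFn_posPart (hf.toLp f + hg.toLp g), Lp.coeFn_posPart (hf.toLp f),
          Lp.coeFn_posPart (hg.toLp g), Lp.coeFn_add (hf.toLp f) (hg.toLp g), hf.coeFn_toLp,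
          hg.coeFn_toLp, Lp.coeFn_add (Lp.posPart (hf.toLp f)) (Lp.posPart (hg.toLp g))]
          with x h1 h2 h3 h4 h5 h6 h7
        rw [h1, h7, h4, Pi.add_apply, Pi.add_apply, h2, h3, h5, h6]
        by_cases hx : f x = 0
        · simp [hx]
        · have : g x = 0 := by
            by_contra hx'
            exact Set.disjoint_left.1 hfg hx hx'
          simp [this]
      rw [this, map_add]
      exact add_nonneg h1 h2
    · exact isClosed_Ici.preimage (Q.continuous.comp Lp.continuous_posPart)
  have : Lp.posPart f = f := by
    ext1
    rw [← Lp.coeFn_nonneg] at hf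
    filter_upwards [Lp.coeFn_posPart f, hf] with x h1 h2
    rw [h1]
    exact max_eq_left h2
  rwa [this] at key

/-- The Markov operator is 2R - I, where R is a weak limit of powers of T along an ultrafilter of
return times; a sequence with the same limit R is then extracted. -/
theorem Automorphism.HalfReturning.isPartiallyRigid [MeasurableSpace.CountablyGenerated X]
    {T : Automorphism μ} (hT : T.HalfReturning) : T.IsPartiallyRigid (1 / 2) := by
  have : Fact ((2 : ENNReal) ≠ ⊤) := ⟨ENNReal.ofNat_ne_top⟩
  obtain ⟨m, hm, h⟩ := exists_net_of_forall_finset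
    (p := fun A ε m => μ.real A / 2 - ε ≤ μ.real (A ∩ T.toEquiv^[m] ⁻¹' A))
    (fun A ε ε' m h1 h2 => by linarith) hT
  let U := Ultrafilter.of (atTop : Filter (Finset {A : Set X // MeasurableSet A} × ℕ))
  obtain ⟨R, hR⟩ := exists_weakLimit_of_ultrafilter U (fun i => T.koopman ^ m i)
    fun i f => (T.norm_koopman_pow_apply _ f).le
  have hmU : Tendsto m U atTop := hm.mono_left (Ultrafilter.of_le _)
  obtain ⟨s, hs, hs'⟩ := exists_seq_of_net (κ := ℕ × ℕ) hmU
    (φ := fun n k => ⟪(T.koopman ^ k) (TopologicalSpace.denseSeq (Lp ℝ 2 μ) n.1),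
      TopologicalSpace.denseSeq (Lp ℝ 2 μ) n.2⟫_ℝ)
    fun n => hR (TopologicalSpace.denseSeq (Lp ℝ 2 μ) n.1) (TopologicalSpace.denseSeq (Lp ℝ 2 μ) n.2)
  have hd := TopologicalSpace.denseRange_denseSeq (Lp ℝ 2 μ)
  have hlim : ∀ f g, Tendsto (fun i => ⟪(T.koopman ^ s i) f, g⟫_ℝ) atTop (𝓝 ⟪R f, g⟫_ℝ) := by
    intro f g
    refine closure_minimal (Set.range_subset_iff.2 fun b => ?_)
      (isClosed_setOf_tendsto_inner (C := ‖f‖₊) (fun i => (T.norm_koopman_pow_apply _ f).le) (R f))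
      (hd g)
    exact closure_minimal (Set.range_subset_iff.2 fun a => hs' (a, b))
      (T.isClosed_setOf_tendsto_inner_koopman_pow s R _) (hd f)
  have hone : ∀ n, (T.koopman ^ n) (Lp.const 2 μ (1 : ℝ)) = Lp.const 2 μ 1 := fun n => by
    rw [const_one_eq_ind, T.koopman_pow_ind]
    rfl
  have hRone : R (Lp.const 2 μ (1 : ℝ)) = Lp.const 2 μ 1 := by
    refine ext_inner_right ℝ fun g => ?_
    refine tendsto_nhds_unique (hlim _ g) ?_
    simp_rw [hone]
    exact tendsto_const_nhds
  have hRone' : ∀ f, ⟪R f, Lp.const 2 μ (1 : ℝ)⟫_ℝ = ⟪f, Lp.const 2 μ (1 : ℝ)⟫_ℝ := by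
    intro f
    refine tendsto_nhds_unique (hlim f _) ?_
    have : ∀ i, ⟪(T.koopman ^ s i) f, Lp.const 2 μ (1 : ℝ)⟫_ℝ = ⟪f, Lp.const 2 μ (1 : ℝ)⟫_ℝ := by
      intro i
      conv_lhs => rw [← hone (s i)]
      simp_rw [T.koopman_pow_apply]
      exact (Lp.compMeasurePreservingₗᵢ ℝ _ (T.measurePreserving.iterate (s i))).inner_map_map f _
    simp_rw [this]
    exact tendsto_const_nhds
  have hhalf : ∀ A B (hA : MeasurableSet A) (hB : MeasurableSet B),
      μ.real (A ∩ B) / 2 ≤ ⟪R (ind μ hA), ind μ hB⟫_ℝ := by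
    intro A B hA hB
    refine le_of_forall_pos_sub_le fun ε hε => ?_
    refine ge_of_tendsto (hR _ _) (Ultrafilter.of_le _ ?_)
    -- Half-return is applied to A ∩ B: a return to A ∩ B is in particular a passage between A and
    -- B.
    filter_upwards [h (A ∩ B) (hA.inter hB) ε hε] with i hi
    refine hi.trans ?_
    rw [T.koopman_pow_ind, inner_ind_ind]
    exact measureReal_mono (fun x hx => ⟨hx.2.1, hx.1.2⟩) (measure_ne_top _ _)
  refine ⟨s, (2 : ℝ) • R - ContinuousLinearMap.id ℝ _, hs, ⟨fun f hf => ?_, ?_, ?_⟩, fun f g => ?_⟩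
  · refine map_nonneg_of_forall_inner_ind_nonneg (fun A B hA hB => ?_) hf
    have := hhalf A B hA hB
    simp only [sub_apply, smul_apply,
      ContinuousLinearMap.id_apply, inner_sub_left, real_inner_smul_left, inner_ind_ind]
    linarith
  · simp only [sub_apply, smul_apply,
      ContinuousLinearMap.id_apply, hRone]
    rw [two_smul, add_sub_cancel_right]
  · refine ext_inner_right ℝ fun f => ?_
    rw [ContinuousLinearMap.adjoint_inner_left, real_inner_comm]
    simp only [sub_apply, smul_apply,
      ContinuousLinearMap.id_apply, inner_sub_left, real_inner_smul_left, hRone']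
    rw [real_inner_comm]
    ring
  · convert hlim f g using 3
    simp only [sub_apply, smul_apply,
      ContinuousLinearMap.id_apply]
    module

end Koopman

end ErgodicWH

namespace ErgodicWH

/-! ### Weak homoclinicity in terms of sets. -/

section AsymptoticallyFixed

variable {X : Type*} [MeasurableSpace X] {μ : Measure X}

/-- The orbits of `y` and of `R y` under `T` are asymptotically together, in Cesàro mean and for
most `y`, as far as any measurable set can tell. -/
def AsympFixed (μ : Measure X) (T R : X → X) : Prop :=
  ∀ A, MeasurableSet A →
    Tendsto (fun N : ℕ => (1 / (N : ℝ)) *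
      ∑ i ∈ Finset.Icc 1 N, μ.real ((R ⁻¹' (T^[i] ⁻¹' A)) ∆ (T^[i] ⁻¹' A))) atTop (𝓝 0)

variable [IsFiniteMeasure μ]

lemma Automorphism.inner_conj_ind (T S : Automorphism μ) (i : ℕ) {A : Set X}
    (hA : MeasurableSet A) :
    ⟪(T.symm.koopman ^ i * S.koopman * T.koopman ^ i) (ind μ hA), ind μ hA⟫_ℝ =
      μ.real ((S.toEquiv ⁻¹' (T.toEquiv^[i] ⁻¹' A)) ∩ (T.toEquiv^[i] ⁻¹' A)) := by
  have hTA := T.measurableSet_preimage_iterate i hA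
  have h1 : (T.symm.koopman ^ i * S.koopman * T.koopman ^ i) (ind μ hA) =
      ind μ (T.symm.measurableSet_preimage_iterate i (hTA.preimage S.toEquiv.measurable)) := by
    change (T.symm.koopman ^ i) (S.koopman ((T.koopman ^ i) (ind μ hA))) = _
    rw [T.koopman_pow_ind, S.koopman_apply, compMeasurePreserving_ind, T.symm.koopman_pow_ind]
  rw [h1, inner_ind_ind, ← T.measureReal_preimage_iterate i
    ((T.symm.measurableSet_preimage_iterate i (hTA.preimage S.toEquiv.measurable)).inter hA)]
  congr 1
  have hinv : Function.LeftInverse (T.symm.toEquiv^[i]) (T.toEquiv^[i]) :=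
    Function.LeftInverse.iterate (fun x => T.toEquiv.symm_apply_apply x) i
  ext x
  simp only [Set.mem_preimage, Set.mem_inter_iff, hinv x]

/-- Pair the defining averages, applied to an indicator, with the same indicator. Both sets in each
symmetric difference have measure μ(A), so its measure is 2μ(A) minus twice the overlap. -/
lemma asympFixed_of_mem_weaklyHomoclinic {T S : Automorphism μ} (hS : S ∈ weaklyHomoclinic T) :
    AsympFixed μ T.toEquiv S.toEquiv := by
  intro A hA
  have h1 : Tendsto (fun N : ℕ => (1 / (N : ℝ)) * ∑ i ∈ Finset.Icc 1 N,
      μ.real ((S.toEquiv ⁻¹' (T.toEquiv^[i] ⁻¹' A)) ∩ (T.toEquiv^[i] ⁻¹' A))) atTop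
      (𝓝 (μ.real A)) := by
    have := (hS (ind μ hA)).inner (tendsto_const_nhds (x := ind μ hA)) (𝕜 := ℝ)
    rw [inner_ind_ind, Set.inter_self] at this
    refine this.congr fun N => ?_
    rw [real_inner_smul_left, sum_inner]
    simp_rw [T.inner_conj_ind S _ hA]
  have h2 : Tendsto (fun N : ℕ => 2 * μ.real A - 2 * ((1 / (N : ℝ)) * ∑ i ∈ Finset.Icc 1 N,
      μ.real ((S.toEquiv ⁻¹' (T.toEquiv^[i] ⁻¹' A)) ∩ (T.toEquiv^[i] ⁻¹' A)))) atTop (𝓝 0) := by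
    simpa using (h1.const_mul 2).const_sub (2 * μ.real A)
  refine h2.congr' ?_
  filter_upwards [eventually_gt_atTop 0] with N hN
  have hN' : (N : ℝ) ≠ 0 := by positivity
  have h3 : ∀ i, μ.real ((S.toEquiv ⁻¹' (T.toEquiv^[i] ⁻¹' A)) ∆ (T.toEquiv^[i] ⁻¹' A)) =
      2 * μ.real A -
        2 * μ.real ((S.toEquiv ⁻¹' (T.toEquiv^[i] ⁻¹' A)) ∩ (T.toEquiv^[i] ⁻¹' A)) := by
    intro i
    have hTA := T.measurableSet_preimage_iterate i hA
    rw [measureReal_symmDiff_eq_sub (hTA.preimage S.toEquiv.measurable) hTA,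
      S.measurePreserving.measureReal_preimage hTA.nullMeasurableSet,
      T.measureReal_preimage_iterate i hA]
    ring
  simp_rw [h3, Finset.sum_sub_distrib, Finset.sum_const, ← Finset.mul_sum]
  simp only [Nat.card_Icc, add_tsub_cancel_right, nsmul_eq_mul]
  field_simp

/-- Triangle inequality through the preimage under R', which preserves μ. It is needed for the
iterates of S in the aperiodic case. -/
lemma AsympFixed.comp {T R R' : X → X} (hT : Measurable T) (hR : AsympFixed μ T R)
    (hR' : AsympFixed μ T R') (hRm : Measurable R) (hR'm : MeasurePreserving R' μ μ) :
    AsympFixed μ T (R ∘ R') := by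
  intro A hA
  have h := (hR A hA).add (hR' A hA)
  rw [add_zero] at h
  refine squeeze_zero (fun N => by positivity) (fun N => ?_) h
  rw [← mul_add, ← Finset.sum_add_distrib]
  gcongr with i
  have hTA : MeasurableSet (T^[i] ⁻¹' A) := hA.preimage (hT.iterate i)
  refine (measureReal_symmDiff_le (t := R' ⁻¹' (T^[i] ⁻¹' A)) _).trans ?_
  refine add_le_add (le_of_eq ?_) le_rfl
  rw [Set.preimage_comp, ← Set.preimage_symmDiff, hR'm.measureReal_preimage]
  exact ((hTA.preimage hRm).symmDiff hTA).nullMeasurableSet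

lemma AsympFixed.iterate {T R : X → X} (hT : Measurable T) (hR : AsympFixed μ T R)
    (hRm : MeasurePreserving R μ μ) (n : ℕ) : AsympFixed μ T R^[n] := by
  induction n with
  | zero => intro A _; simp
  | succ n ih => exact ih.comp hT hR (hRm.iterate n).measurable hRm

end AsymptoticallyFixed

/-! ### Levels, strips and cells of towers. -/

section Strips

variable {X : Type*}

/-- The union of the levels with indices in `[u, v)`. -/
def strip (T : X → X) (E : Set X) (u v : ℕ) : Set X := ⋃ i ∈ Finset.Ico u v, T^[i] '' E

lemma mem_strip {T : X → X} {E : Set X} {u v : ℕ} {x : X} :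
    x ∈ strip T E u v ↔ ∃ i, u ≤ i ∧ i < v ∧ x ∈ T^[i] '' E := by
  simp [strip, and_assoc]

lemma strip_mono {T : X → X} {E : Set X} {u v u' v' : ℕ} (hu : u' ≤ u) (hv : v ≤ v') :
    strip T E u v ⊆ strip T E u' v' := by
  intro x hx
  obtain ⟨i, h1, h2, h3⟩ := mem_strip.1 hx
  exact mem_strip.2 ⟨i, hu.trans h1, h2.trans_le hv, h3⟩

lemma iterate_mem_level {T : X → X} {E : Set X} {i : ℕ} {x : X} (n : ℕ) (hx : x ∈ T^[i] '' E) :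
    T^[n] x ∈ T^[n + i] '' E := by
  obtain ⟨y, hy, rfl⟩ := hx
  exact ⟨y, hy, Function.iterate_add_apply T n i y⟩

lemma mem_level_of_iterate_mem {T : X → X} (hT : Function.Injective T) {E : Set X} {i n : ℕ} {x : X}
    (hx : T^[n] x ∈ T^[n + i] '' E) : x ∈ T^[i] '' E := by
  obtain ⟨y, hy, h⟩ := hx
  rw [Function.iterate_add_apply] at h
  exact ⟨y, hy, hT.iterate n h⟩

lemma strip_zero_eq_iUnion_fin (T : X → X) (E : Set X) (h : ℕ) :
    strip T E 0 h = ⋃ i : Fin h, T^[(i : ℕ)] '' E := by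
  ext x
  rw [mem_strip, Set.mem_iUnion]
  exact ⟨fun ⟨i, _, h2, h3⟩ => ⟨⟨i, h2⟩, h3⟩, fun ⟨i, hi⟩ => ⟨i, Nat.zero_le _, i.2, hi⟩⟩

end Strips

section Towers

variable {X : Type*} [MeasurableSpace X] {μ : Measure X}

/-- The levels `E, T E, …, T^(h-1) E` are pairwise disjoint measurable sets. -/
structure IsTower (T : X → X) (E : Set X) (h : ℕ) : Prop where
  measurableSet : MeasurableSet E
  disjoint : ∀ a < h, ∀ b < h, a ≠ b → Disjoint (T^[a] '' E) (T^[b] '' E)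

/-- A measurable union of cells of the partition given by a tower. -/
structure IsCellSet (T : X → X) (E : Set X) (h : ℕ) (B : Set X) : Prop where
  measurableSet : MeasurableSet B
  level : ∀ i < h, ∀ x ∈ T^[i] '' E, ∀ x' ∈ T^[i] '' E, x ∈ B → x' ∈ B
  rest : ∀ x ∉ strip T E 0 h, ∀ x' ∉ strip T E 0 h, x ∈ B → x' ∈ B

lemma Automorphism.measurableSet_level (T : Automorphism μ) {E : Set X} (hE : MeasurableSet E)
    (i : ℕ) : MeasurableSet (T.toEquiv^[i] '' E) := by
  induction i with
  | zero => simpa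
  | succ i ih =>
    rw [Function.iterate_succ', Set.image_comp]
    exact T.toEquiv.measurableSet_image.2 ih

lemma Automorphism.measureReal_level (T : Automorphism μ) {E : Set X} (hE : MeasurableSet E)
    (i : ℕ) : μ.real (T.toEquiv^[i] '' E) = μ.real E := by
  rw [← T.measureReal_preimage_iterate i (T.measurableSet_level hE i),
    (T.toEquiv.injective.iterate i).preimage_image]

lemma Automorphism.measurableSet_strip (T : Automorphism μ) {E : Set X} (hE : MeasurableSet E)
    (u v : ℕ) : MeasurableSet (strip T.toEquiv E u v) :=
  Finset.measurableSet_biUnion _ fun i _ => T.measurableSet_level hE i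

lemma measureReal_biUnion_levels [IsFiniteMeasure μ] {T : Automorphism μ} {E : Set X} {h : ℕ}
    (hE : IsTower T.toEquiv E h) {I : Finset ℕ} (hI : ∀ i ∈ I, i < h) :
    μ.real (⋃ i ∈ I, T.toEquiv^[i] '' E) = I.card * μ.real E := by
  rw [measureReal_biUnion_finset]
  · simp_rw [T.measureReal_level hE.measurableSet]
    simp
  · intro a ha b hb hab
    exact hE.disjoint a (hI a ha) b (hI b hb) hab
  · exact fun i _ => T.measurableSet_level hE.measurableSet i

lemma measureReal_strip [IsFiniteMeasure μ] {T : Automorphism μ} {E : Set X} {h : ℕ}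
    (hE : IsTower T.toEquiv E h) {u v : ℕ} (hv : v ≤ h) :
    μ.real (strip T.toEquiv E u v) = (v - u : ℕ) * μ.real E := by
  rw [strip, measureReal_biUnion_levels hE, Nat.card_Ico]
  intro i hi
  exact (Finset.mem_Ico.1 hi).2.trans_le hv

lemma mul_measureReal_base_le_one [IsProbabilityMeasure μ] {T : Automorphism μ} {E : Set X} {h : ℕ}
    (hE : IsTower T.toEquiv E h) : h * μ.real E ≤ 1 := by
  have := measureReal_strip (μ := μ) hE (u := 0) le_rfl
  rw [Nat.sub_zero] at this
  rw [← this]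
  exact measureReal_le_one

lemma level_unique {T : X → X} {E : Set X} {h : ℕ} (hE : IsTower T E h) {a b : ℕ} (ha : a < h)
    (hb : b < h) {x : X} (hxa : x ∈ T^[a] '' E) (hxb : x ∈ T^[b] '' E) : a = b := by
  by_contra hab
  exact Set.disjoint_left.1 (hE.disjoint a ha b hb hab) hxa hxb

lemma isCellSet_biUnion_towerCell {T : Automorphism μ} {E : Set X} {h : ℕ}
    (hE : IsTower T.toEquiv E h) (s : Set (Option (Fin h))) :
    IsCellSet T.toEquiv E h (⋃ c ∈ s, towerCell T.toEquiv E h c) where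
  measurableSet := by
    refine MeasurableSet.biUnion (Set.to_countable s) fun c _ => ?_
    cases c with
    | none =>
      rw [towerCell, ← strip_zero_eq_iUnion_fin]
      exact (T.measurableSet_strip hE.measurableSet 0 h).compl
    | some i => exact T.measurableSet_level hE.measurableSet i
  level i hi x hx x' hx' h := by
    simp only [Set.mem_iUnion] at h ⊢
    obtain ⟨c, hc, hxc⟩ := h
    cases c with
    | none =>
      rw [towerCell, ← strip_zero_eq_iUnion_fin] at hxc
      exact absurd (mem_strip.2 ⟨i, Nat.zero_le _, hi, hx⟩) hxc
    | some k =>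
      refine ⟨some k, hc, ?_⟩
      obtain rfl := level_unique hE hi k.2 hx hxc
      exact hx'
  rest x hx x' hx' h := by
    simp only [Set.mem_iUnion] at h ⊢
    obtain ⟨c, hc, hxc⟩ := h
    cases c with
    | none =>
      refine ⟨none, hc, ?_⟩
      rw [towerCell, ← strip_zero_eq_iUnion_fin]
      exact hx'
    | some k => exact absurd (mem_strip.2 ⟨k, Nat.zero_le _, k.2, hxc⟩) hx

/-- A finite family of sets that can be approximated, together with many of their translates, by
unions of cells of a tower of bounded height, has an approximate period. -/
lemma exists_period_of_height_eq [IsFiniteMeasure μ] (T : Automorphism μ) (𝒜 : Finset (Set X))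
    (h𝒜 : ∀ A ∈ 𝒜, MeasurableSet A) (h : ℕ) :
    ∃ N : ℕ, ∀ (E : Set X) (ε : ℝ),
      (∀ n ∈ Finset.range (N + 1), ∀ A ∈ 𝒜, ∃ s : Set (Option (Fin h)),
        μ.real ((T.toEquiv^[n] ⁻¹' A) ∆ ⋃ c ∈ s, towerCell T.toEquiv E h c) < ε) →
      ∃ k : ℕ, 0 < k ∧ ∀ A ∈ 𝒜, μ.real (A ∆ (T.toEquiv^[k] ⁻¹' A)) ≤ 2 * ε := by
  classical
  let K := 𝒜 → Set (Option (Fin h))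
  -- With one more time than there are choices of cells, two times n < n' share their approximants,
  -- and n' - n is the period. The bound depends neither on the base nor on ε.
  refine ⟨Fintype.card K, fun E ε hs => ?_⟩
  have hs' : ∀ n : Fin (Fintype.card K + 1), ∀ A : 𝒜, ∃ s : Set (Option (Fin h)),
      μ.real ((T.toEquiv^[n] ⁻¹' A) ∆ ⋃ c ∈ s, towerCell T.toEquiv E h c) < ε :=
    fun n A => hs n (Finset.mem_range.2 n.2) A A.2
  choose s hs' using hs'
  obtain ⟨n, n', hnn, hsn⟩ := Fintype.exists_ne_map_eq_of_card_lt s (by simp [K])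
  wlog hlt : n < n' generalizing n n'
  · exact this n' n hnn.symm hsn.symm (lt_of_le_of_ne (not_lt.1 hlt) hnn.symm)
  refine ⟨n' - n, Nat.sub_pos_of_lt hlt, fun A hA => ?_⟩
  have hm := (h𝒜 A hA).symmDiff (T.measurableSet_preimage_iterate (n' - n) (h𝒜 A hA))
  rw [← T.measureReal_preimage_iterate n hm, Set.preimage_symmDiff, ← Set.preimage_comp,
    ← Function.iterate_add, Nat.sub_add_cancel (Nat.le_of_lt hlt)]
  refine (measureReal_symmDiff_le (t := ⋃ c ∈ s n ⟨A, hA⟩, towerCell T.toEquiv E h c) _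
    (measure_ne_top _ _) (measure_ne_top _ _)).trans ?_
  have h1 := hs' n ⟨A, hA⟩
  have h2 := hs' n' ⟨A, hA⟩
  rw [← hsn, symmDiff_comm] at h2
  linarith

end Towers

end ErgodicWH

namespace ErgodicWH

/-! ### Parallel climbing in tall towers. -/

section RankOne

variable {X : Type*} [MeasurableSpace X] {μ : Measure X}

/-- A sequence of towers that witnesses rank one, with heights tending to infinity. -/
structure IsRankOneSeq (T : Automorphism μ) (E : ℕ → Set X) (h : ℕ → ℕ) : Prop where
  tower : ∀ j, IsTower T.toEquiv (E j) (h j)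
  approx : ∀ A, MeasurableSet A → ∀ ε : ℝ, 0 < ε →
    ∀ᶠ j in atTop, ∃ B, IsCellSet T.toEquiv (E j) (h j) B ∧ μ.real (A ∆ B) < ε
  tendsto : Tendsto h atTop atTop

lemma Automorphism.IsRankOne.approxPeriodic_or [IsFiniteMeasure μ] {T : Automorphism μ}
    (hT : T.IsRankOne) : T.ApproxPeriodic ∨ ∃ E h, IsRankOneSeq T E h := by
  obtain ⟨E, h, hE, -, hdisj, happ⟩ := hT
  have htower : ∀ j, IsTower T.toEquiv (E j) (h j) := fun j => ⟨hE j, fun a ha b hb hab =>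
    @hdisj j ⟨a, ha⟩ ⟨b, hb⟩ (by simpa using hab)⟩
  have happ' : ∀ A, MeasurableSet A → ∀ ε : ℝ, 0 < ε → ∀ᶠ j in atTop,
      ∃ s : Set (Option (Fin (h j))),
        μ.real (A ∆ ⋃ c ∈ s, towerCell T.toEquiv (E j) (h j) c) < ε := by
    intro A hA ε hε
    filter_upwards [happ A hA (ENNReal.ofReal ε) (by simpa using hε)] with j ⟨s, hs⟩
    exact ⟨s, (ENNReal.lt_ofReal_iff_toReal_lt (measure_ne_top _ _)).1 hs⟩
  by_cases hh : Tendsto h atTop atTop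
  · refine Or.inr ⟨E, h, htower, fun A hA ε hε => ?_, hh⟩
    filter_upwards [happ' A hA ε hε] with j ⟨s, hs⟩
    exact ⟨_, isCellSet_biUnion_towerCell (htower j) s, hs⟩
  · left
    -- Heights that do not tend to infinity take some value infinitely often, so arbitrarily fine
    -- approximation is available at one fixed height.
    have hfreq : ∃ H, ∃ᶠ j in atTop, h j = H := by
      by_contra hcon
      simp only [not_exists, not_frequently] at hcon
      refine hh (tendsto_atTop.2 fun b => ?_)
      have := (eventually_all_finite (Set.finite_Iio b)).2 fun H _ => hcon H
      filter_upwards [this] with j hj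
      by_contra hlt
      exact hj _ (Set.mem_Iio.2 (not_le.1 hlt)) rfl
    obtain ⟨H, hH⟩ := hfreq
    intro 𝒜 h𝒜 ε hε
    obtain ⟨N, hN⟩ := exists_period_of_height_eq T 𝒜 h𝒜 H
    have hev : ∀ᶠ j in atTop, ∀ n ∈ Finset.range (N + 1), ∀ A ∈ 𝒜,
        ∃ s : Set (Option (Fin (h j))), μ.real ((T.toEquiv^[n] ⁻¹' A) ∆
          ⋃ c ∈ s, towerCell T.toEquiv (E j) (h j) c) < ε / 2 := by
      refine (Finset.eventually_all _).2 fun n _ => (Finset.eventually_all _).2 fun A hA => ?_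
      exact happ' _ (T.measurableSet_preimage_iterate n (h𝒜 A hA)) _ (by positivity)
    obtain ⟨j, rfl, hj⟩ := (hH.and_eventually hev).exists
    obtain ⟨k, hk, hk'⟩ := hN (E j) (ε / 2) hj
    exact ⟨k, hk, fun A hA => (hk' A hA).trans_eq (by ring)⟩

lemma exists_measureReal_iUnion_sdiff_le [IsFiniteMeasure μ] {V : ℕ → Set X}
    (hV : ∀ n, MeasurableSet (V n)) {δ : ℝ} (hδ : 0 < δ) :
    ∃ N, μ.real ((⋃ n, V n) \ ⋃ n ∈ Finset.range N, V n) ≤ δ := by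
  let G : ℕ → Set X := fun N => ⋃ n ∈ Finset.range N, V n
  have hGm : ∀ N, MeasurableSet (G N) := fun N => Finset.measurableSet_biUnion _ fun n _ => hV n
  have hGmono : Monotone G := fun N N' hN =>
    Set.biUnion_subset_biUnion_left (Finset.coe_subset.2 (Finset.range_mono hN))
  have hGU : ⋃ N, G N = ⋃ n, V n := by
    ext x
    simp only [G, Set.mem_iUnion, Finset.mem_range]
    exact ⟨fun ⟨_, n, _, hn⟩ => ⟨n, hn⟩, fun ⟨n, hn⟩ => ⟨n + 1, n, Nat.lt_succ_self n, hn⟩⟩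
  have hlim : Tendsto (fun N => μ.real (G N)) atTop (𝓝 (μ.real (⋃ N, G N))) :=
    (ENNReal.tendsto_toReal (measure_ne_top _ _)).comp (tendsto_measure_iUnion_atTop hGmono)
  obtain ⟨N, hN⟩ := (hlim.eventually_const_lt
    (show μ.real (⋃ N, G N) - δ < _ by linarith)).exists
  refine ⟨N, ?_⟩
  rw [← hGU, measureReal_sdiff (Set.subset_iUnion G N) (hGm N)]
  linarith

/-- Some member of a countable separating family distinguishes y from R y ≠ y, and finitely many
members suffice up to small measure. A union of cells cannot distinguish two points of one level, so
y or R y lies in the small error set of an approximation. -/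
lemma IsRankOneSeq.eventually_same_level_small [IsFiniteMeasure μ]
    [MeasurableSpace.CountablySeparated X]
    {T : Automorphism μ} {E : ℕ → Set X} {h : ℕ → ℕ} (hT : IsRankOneSeq T E h)
    {R : X → X} (hR : MeasurePreserving R μ μ) {δ : ℝ} (hδ : 0 < δ) :
    ∀ᶠ j in atTop, μ.real {y | R y ≠ y ∧ ∃ i < h j, y ∈ T.toEquiv^[i] '' E j ∧
      R y ∈ T.toEquiv^[i] '' E j} ≤ δ := by
  obtain ⟨A, hA, hsep⟩ := exists_seq_separating X MeasurableSet.empty Set.univ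
  have hsep' : {y | R y ≠ y} ⊆ ⋃ n, A n ∆ (R ⁻¹' A n) := by
    intro y hy
    by_contra hcon
    refine hy (hsep _ (Set.mem_univ _) _ (Set.mem_univ _) fun n => ?_)
    rw [Set.mem_iUnion, not_exists] at hcon
    have := hcon n
    rw [Set.mem_symmDiff, Set.mem_preimage] at this
    tauto
  have hm : ∀ n, MeasurableSet (A n ∆ (R ⁻¹' A n)) := fun n =>
    (hA n).symmDiff ((hA n).preimage hR.measurable)
  obtain ⟨N, hN⟩ := exists_measureReal_iUnion_sdiff_le (μ := μ) hm (half_pos hδ)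
  have hev := (Finset.eventually_all (Finset.range N)).2 fun n _ =>
    hT.approx (A n) (hA n) (δ / (4 * (N + 1))) (by positivity)
  filter_upwards [hev] with j hj
  choose! B hB hB' using hj
  have hsub : {y | R y ≠ y ∧ ∃ i < h j, y ∈ T.toEquiv^[i] '' E j ∧ R y ∈ T.toEquiv^[i] '' E j} ⊆
      ((⋃ n, A n ∆ (R ⁻¹' A n)) \ ⋃ n ∈ Finset.range N, A n ∆ (R ⁻¹' A n)) ∪
        ⋃ n ∈ Finset.range N, (A n ∆ B n) ∪ (R ⁻¹' (A n ∆ B n)) := by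
    rintro y ⟨hy, i, hi, hyi, hRyi⟩
    by_cases hyG : y ∈ ⋃ n ∈ Finset.range N, A n ∆ (R ⁻¹' A n)
    · right
      simp only [Set.mem_iUnion] at hyG ⊢
      obtain ⟨n, hn, hyn⟩ := hyG
      refine ⟨n, hn, ?_⟩
      have h1 := (hB n hn).level i hi y hyi (R y) hRyi
      have h2 := (hB n hn).level i hi (R y) hRyi y hyi
      simp only [Set.mem_union, Set.mem_symmDiff, Set.mem_preimage] at hyn ⊢
      tauto
    · exact Or.inl ⟨hsep' hy, hyG⟩
  have hterm : ∀ n ∈ Finset.range N, μ.real ((A n ∆ B n) ∪ (R ⁻¹' (A n ∆ B n))) ≤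
      δ / (2 * (N + 1)) := by
    intro n hn
    refine (measureReal_union_le _ _).trans ?_
    rw [hR.measureReal_preimage ((hA n).symmDiff (hB n hn).measurableSet).nullMeasurableSet]
    have := hB' n hn
    calc _ ≤ δ / (4 * (N + 1)) + δ / (4 * (N + 1)) := by linarith
      _ = _ := by field_simp; ring
  calc _ ≤ _ := measureReal_mono hsub (measure_ne_top _ _)
    _ ≤ _ := measureReal_union_le _ _
    _ ≤ δ / 2 + ∑ n ∈ Finset.range N, δ / (2 * (N + 1)) :=
      add_le_add hN ((measureReal_biUnion_finset_le _ _).trans (Finset.sum_le_sum hterm))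
    _ ≤ δ := by
      rw [Finset.sum_const, Finset.card_range, nsmul_eq_mul]
      have : (N : ℝ) * (δ / (2 * (N + 1))) ≤ δ / 2 := by
        rw [mul_div_assoc', div_le_div_iff₀ (by positivity) (by positivity)]
        nlinarith
      linarith

open Classical in
/-- The number of times `1 ≤ i ≤ N` at which exactly one of `T^i u` and `T^i v` lies in `B`. -/
noncomputable def mismatches {X : Type*} (T : X → X) (B : Set X) (N : ℕ) (u v : X) : ℕ :=
  ((Finset.Icc 1 N).filter fun i => u ∈ (T^[i] ⁻¹' B) ↔ v ∉ (T^[i] ⁻¹' B)).card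

lemma mismatches_comm {X : Type*} (T : X → X) (B : Set X) (N : ℕ) (u v : X) :
    mismatches T B N u v = mismatches T B N v u := by
  classical
  unfold mismatches
  congr 1
  exact Finset.filter_congr fun i _ => by tauto

/-- Markov's inequality: the right-hand side is the integral of the number of mismatches. -/
lemma mul_measureReal_mismatches_le [IsFiniteMeasure μ] {T : Automorphism μ} {R : X → X}
    (hR : Measurable R) {B : Set X} (hB : MeasurableSet B) (N : ℕ) (c : ℝ) :
    c * μ.real {y | c ≤ mismatches T.toEquiv B N y (R y)} ≤
      ∑ i ∈ Finset.Icc 1 N, μ.real ((R ⁻¹' (T.toEquiv^[i] ⁻¹' B)) ∆ (T.toEquiv^[i] ⁻¹' B)) := by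
  classical
  have hm : ∀ i, MeasurableSet ((R ⁻¹' (T.toEquiv^[i] ⁻¹' B)) ∆ (T.toEquiv^[i] ⁻¹' B)) := fun i =>
    ((T.measurableSet_preimage_iterate i hB).preimage hR).symmDiff
      (T.measurableSet_preimage_iterate i hB)
  have heq : ∀ y, (mismatches T.toEquiv B N y (R y) : ℝ) = ∑ i ∈ Finset.Icc 1 N,
      ((R ⁻¹' (T.toEquiv^[i] ⁻¹' B)) ∆ (T.toEquiv^[i] ⁻¹' B)).indicator (fun _ => (1 : ℝ)) y := by
    intro y
    rw [mismatches, Finset.card_filter, Nat.cast_sum]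
    refine Finset.sum_congr rfl fun i _ => ?_
    rw [Set.indicator_apply, Nat.cast_ite, Nat.cast_one, Nat.cast_zero]
    congr 1
    rw [Set.mem_symmDiff]
    simp only [Set.mem_preimage, eq_iff_iff]
    tauto
  have hint : ∀ i ∈ Finset.Icc 1 N, Integrable
      (((R ⁻¹' (T.toEquiv^[i] ⁻¹' B)) ∆ (T.toEquiv^[i] ⁻¹' B)).indicator fun _ => (1 : ℝ)) μ :=
    fun i _ => (integrable_const 1).indicator (hm i)
  have := mul_meas_ge_le_integral_of_nonneg (μ := μ)
    (f := fun y => (mismatches T.toEquiv B N y (R y) : ℝ))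
    (Eventually.of_forall fun y => Nat.cast_nonneg _)
    (by simp_rw [heq]; exact integrable_finsetSum _ hint) c
  refine this.trans_eq ?_
  simp_rw [heq]
  rw [integral_finsetSum _ hint]
  refine Finset.sum_congr rfl fun i _ => ?_
  rw [integral_indicator_const _ (hm i), smul_eq_mul, mul_one]

lemma IsRankOneSeq.eventually_exists_few_mismatches [IsFiniteMeasure μ]
    {T : Automorphism μ} {E : ℕ → Set X} {h : ℕ → ℕ} (hT : IsRankOneSeq T E h)
    {R : X → X} (hR : MeasurePreserving R μ μ) (hRT : AsympFixed μ T.toEquiv R)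
    {A : Set X} (hA : MeasurableSet A) {δ : ℝ} (hδ : 0 < δ) :
    ∀ᶠ j in atTop, ∃ B, IsCellSet T.toEquiv (E j) (h j) B ∧ μ.real (A ∆ B) ≤ δ ∧
      μ.real {y | δ * h j ≤ mismatches T.toEquiv B (2 * h j) y (R y)} ≤ δ := by
  have h2 : Tendsto (fun j => 2 * h j) atTop atTop :=
    tendsto_atTop_mono (fun j => by omega) hT.tendsto
  -- Passing from A to B costs two errors δ²/8 per time and the average for A is below δ²/4. Over 2h
  -- times this sums to at most δ²h, and Markov's inequality at threshold δh leaves δ.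
  have hη : 0 < min δ (δ ^ 2 / 8) := by positivity
  filter_upwards [hT.approx A hA _ hη, (((hRT A hA).comp h2).eventually_lt_const
    (show (0 : ℝ) < δ ^ 2 / 4 by positivity)), hT.tendsto.eventually_gt_atTop 0]
    with j ⟨B, hB, hAB⟩ havg hj
  have hj' : (0 : ℝ) < h j := by exact_mod_cast hj
  refine ⟨B, hB, hAB.le.trans (min_le_left _ _), ?_⟩
  have hAB' : μ.real (A ∆ B) ≤ δ ^ 2 / 8 := hAB.le.trans (min_le_right _ _)
  have key := mul_measureReal_mismatches_le (T := T) hR.measurable hB.measurableSet (2 * h j)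
    (δ * h j)
  have hterm : ∀ i, μ.real ((R ⁻¹' (T.toEquiv^[i] ⁻¹' B)) ∆ (T.toEquiv^[i] ⁻¹' B)) ≤
      2 * (δ ^ 2 / 8) + μ.real ((R ⁻¹' (T.toEquiv^[i] ⁻¹' A)) ∆ (T.toEquiv^[i] ⁻¹' A)) := by
    intro i
    have hTAB : μ.real ((T.toEquiv^[i] ⁻¹' A) ∆ (T.toEquiv^[i] ⁻¹' B)) ≤ δ ^ 2 / 8 := by
      rw [← Set.preimage_symmDiff, T.measureReal_preimage_iterate i (hA.symmDiff hB.measurableSet)]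
      exact hAB'
    have hRTAB : μ.real ((R ⁻¹' (T.toEquiv^[i] ⁻¹' B)) ∆ (R ⁻¹' (T.toEquiv^[i] ⁻¹' A))) ≤
        δ ^ 2 / 8 := by
      rw [← Set.preimage_symmDiff, hR.measureReal_preimage, symmDiff_comm]
      · exact hTAB
      · exact ((T.measurableSet_preimage_iterate i hB.measurableSet).symmDiff
          (T.measurableSet_preimage_iterate i hA)).nullMeasurableSet
    have t1 := measureReal_symmDiff_le (μ := μ) (s := R ⁻¹' (T.toEquiv^[i] ⁻¹' B))
      (t := R ⁻¹' (T.toEquiv^[i] ⁻¹' A)) (T.toEquiv^[i] ⁻¹' B) (measure_ne_top _ _)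
      (measure_ne_top _ _)
    have t2 := measureReal_symmDiff_le (μ := μ) (s := R ⁻¹' (T.toEquiv^[i] ⁻¹' A))
      (t := T.toEquiv^[i] ⁻¹' A) (T.toEquiv^[i] ⁻¹' B) (measure_ne_top _ _)
      (measure_ne_top _ _)
    linarith
  have hsum := Finset.sum_le_sum fun i (_ : i ∈ Finset.Icc 1 (2 * h j)) => hterm i
  rw [Finset.sum_add_distrib, Finset.sum_const, Nat.card_Icc, nsmul_eq_mul] at hsum
  simp only [Function.comp_apply, add_tsub_cancel_right] at havg hsum
  push_cast at havg hsum
  rw [one_div_mul_eq_div, div_lt_iff₀ (by positivity)] at havg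
  refine le_of_mul_le_mul_left ?_ (mul_pos hδ hj')
  nlinarith

/-- If the orbits of `u` and `v` rarely disagree about `B` while they climb the tower in parallel
at distance `b - a`, then `B` is almost invariant under `T^(b - a)` on the levels they visit. -/
lemma measureReal_strip_inter_symmDiff_le [IsFiniteMeasure μ] {T : Automorphism μ} {E : Set X}
    {h : ℕ} (hE : IsTower T.toEquiv E h) {B : Set X} (hB : IsCellSet T.toEquiv E h B) {u v : X}
    {n a b : ℕ} (hn : n ≤ h) (hab : a ≤ b) (hu : T.toEquiv^[n] u ∈ T.toEquiv^[a] '' E)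
    (hv : T.toEquiv^[n] v ∈ T.toEquiv^[b] '' E) :
    μ.real (strip T.toEquiv E (a + 1) (h - (b - a)) ∩ (B ∆ (T.toEquiv^[b - a] ⁻¹' B))) ≤
      mismatches T.toEquiv B (2 * h) u v * μ.real E := by
  classical
  let I := (Finset.Ico (a + 1) (h - (b - a))).filter fun i =>
    ∃ x ∈ T.toEquiv^[i] '' E, x ∈ B ∆ (T.toEquiv^[b - a] ⁻¹' B)
  have hIh : ∀ i ∈ I, i < h := fun i hi => by
    have := (Finset.mem_Ico.1 (Finset.mem_filter.1 hi).1).2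
    omega
  have hsub : strip T.toEquiv E (a + 1) (h - (b - a)) ∩ (B ∆ (T.toEquiv^[b - a] ⁻¹' B)) ⊆
      ⋃ i ∈ I, T.toEquiv^[i] '' E := by
    rintro x ⟨hx, hxB⟩
    obtain ⟨i, h1, h2, h3⟩ := mem_strip.1 hx
    simp only [Set.mem_iUnion]
    exact ⟨i, Finset.mem_filter.2 ⟨Finset.mem_Ico.2 ⟨h1, h2⟩, x, h3, hxB⟩, h3⟩
  refine (measureReal_mono hsub (measure_ne_top _ _)).trans ?_
  rw [measureReal_biUnion_levels hE hIh]
  gcongr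
  rw [mismatches]
  -- A bad level i is charged to the time at which u reaches it, when v is on level i + (b - a).
  -- Starting at a + 1 makes this time at least 1 even for n = 0; since n and i are at most h, a
  -- window of 2h suffices.
  refine Finset.card_le_card_of_injOn (fun i => n + (i - a)) ?_ ?_
  · intro i hi
    obtain ⟨hi1, x, hxi, hxB⟩ := Finset.mem_filter.1 (Finset.mem_coe.1 hi)
    rw [Finset.mem_Ico] at hi1
    have hui : T.toEquiv^[n + (i - a)] u ∈ T.toEquiv^[i] '' E := by
      have := iterate_mem_level (i - a) hu
      rwa [← Function.iterate_add_apply, Nat.sub_add_cancel (by omega), add_comm] at this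
    have hvi : T.toEquiv^[n + (i - a)] v ∈ T.toEquiv^[b - a + i] '' E := by
      have := iterate_mem_level (i - a) hv
      rwa [← Function.iterate_add_apply, show i - a + b = b - a + i by omega, add_comm (i - a) n] at this
    have hxi' := iterate_mem_level (b - a) hxi
    have e1 := hB.level i (by omega) _ hui _ hxi
    have e2 := hB.level i (by omega) _ hxi _ hui
    have e3 := hB.level (b - a + i) (by omega) _ hvi _ hxi'
    have e4 := hB.level (b - a + i) (by omega) _ hxi' _ hvi
    refine Finset.mem_coe.2 (Finset.mem_filter.2 ⟨Finset.mem_Icc.2 (by dsimp only; omega), ?_⟩)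
    simp only [Set.mem_symmDiff, Set.mem_preimage] at hxB ⊢
    tauto
  · intro i hi i' hi' hii
    have h1 := (Finset.mem_Ico.1 (Finset.mem_filter.1 (Finset.mem_coe.1 hi)).1).1
    have h2 := (Finset.mem_Ico.1 (Finset.mem_filter.1 (Finset.mem_coe.1 hi')).1).1
    simp only at hii
    omega

/-- For all large `j` and most points `y`: `y` and `R y` are not on the same level of the `j`-th
tower unless they are equal, and if they are, at some time `n`, on levels at distance `k`, then
each set of a given finite family is almost `T^k`-invariant on most of the tower. -/
theorem IsRankOneSeq.eventually_exists_exceptional [IsProbabilityMeasure μ]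
    [MeasurableSpace.CountablySeparated X]
    {T : Automorphism μ} {E : ℕ → Set X} {h : ℕ → ℕ} (hT : IsRankOneSeq T E h)
    {R : X → X} (hR : MeasurePreserving R μ μ) (hRT : AsympFixed μ T.toEquiv R)
    (𝒜 : Finset (Set X)) (h𝒜 : ∀ A ∈ 𝒜, MeasurableSet A) {δ : ℝ} (hδ : 0 < δ) :
    ∀ᶠ j in atTop, ∃ Z, MeasurableSet Z ∧ μ.real Z ≤ δ ∧ ∀ y ∉ Z,
      (R y ≠ y → ∀ i < h j, y ∈ T.toEquiv^[i] '' E j → R y ∉ T.toEquiv^[i] '' E j) ∧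
      ∀ n ≤ h j, ∀ a b, T.toEquiv^[n] y ∈ T.toEquiv^[a] '' E j →
        T.toEquiv^[n] (R y) ∈ T.toEquiv^[b] '' E j → ∀ A ∈ 𝒜,
        μ.real (strip T.toEquiv (E j) (min a b + 1) (h j - (max a b - min a b)) ∩
          (A ∆ (T.toEquiv^[max a b - min a b] ⁻¹' A))) ≤ δ := by
  -- There are |𝒜| + 1 exceptional sets of measure at most η, and three errors η for each set: one
  -- from mismatches, two from replacing A by B.
  have hη : 0 < δ / (3 * (𝒜.card + 1)) := by positivity
  set η := δ / (3 * (𝒜.card + 1)) with hηdef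
  have hcard : (𝒜.card + 1) * η = δ / 3 := by rw [hηdef]; field_simp
  have hη3 : 3 * η ≤ δ := by nlinarith [(Nat.cast_nonneg 𝒜.card : (0 : ℝ) ≤ _)]
  filter_upwards [hT.eventually_same_level_small hR hη, (Finset.eventually_all 𝒜).2 fun A hA =>
    hT.eventually_exists_few_mismatches hR hRT (h𝒜 A hA) hη] with j hj1 hj2
  choose! B hB hAB hB' using hj2
  let Z := {y | R y ≠ y ∧ ∃ i < h j, y ∈ T.toEquiv^[i] '' E j ∧ R y ∈ T.toEquiv^[i] '' E j} ∪
    ⋃ A ∈ 𝒜, {y | η * h j ≤ mismatches T.toEquiv (B A) (2 * h j) y (R y)}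
  refine ⟨toMeasurable μ Z, measurableSet_toMeasurable _ _, ?_, fun y hy => ?_⟩
  · rw [Measure.real, measure_toMeasurable, ← Measure.real]
    calc μ.real Z ≤ _ := measureReal_union_le _ _
      _ ≤ η + ∑ A ∈ 𝒜, η :=
        add_le_add hj1 ((measureReal_biUnion_finset_le _ _).trans (Finset.sum_le_sum hB'))
      _ ≤ δ := by
        rw [Finset.sum_const, nsmul_eq_mul]
        linarith
  · have hyZ : y ∉ Z := fun h' => hy (subset_toMeasurable _ _ h')
    simp only [Z, Set.mem_union, Set.mem_iUnion, not_or, not_exists] at hyZ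
    obtain ⟨hy1, hy2⟩ := hyZ
    refine ⟨fun hne i hi hyi hRyi => hy1 ⟨hne, i, hi, hyi, hRyi⟩, ?_⟩
    intro n hn a b hya hyb A hA
    have hmis : (mismatches T.toEquiv (B A) (2 * h j) y (R y) : ℝ) < η * h j :=
      not_le.1 (hy2 A hA)
    have hB1 : μ.real (strip T.toEquiv (E j) (min a b + 1) (h j - (max a b - min a b)) ∩
        (B A ∆ (T.toEquiv^[max a b - min a b] ⁻¹' B A))) ≤
        mismatches T.toEquiv (B A) (2 * h j) y (R y) * μ.real (E j) := by
      rcases le_total a b with hab | hab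
      · rw [min_eq_left hab, max_eq_right hab]
        exact measureReal_strip_inter_symmDiff_le (hT.tower j) (hB A hA) hn hab hya hyb
      · rw [min_eq_right hab, max_eq_left hab, mismatches_comm]
        exact measureReal_strip_inter_symmDiff_le (hT.tower j) (hB A hA) hn hab hyb hya
    have hB2 : (mismatches T.toEquiv (B A) (2 * h j) y (R y) : ℝ) * μ.real (E j) ≤ η := by
      have := mul_measureReal_base_le_one (hT.tower j)
      have h0 : 0 ≤ μ.real (E j) := measureReal_nonneg
      nlinarith
    generalize max a b - min a b = k at *
    have hsub : strip T.toEquiv (E j) (min a b + 1) (h j - k) ∩ (A ∆ (T.toEquiv^[k] ⁻¹' A)) ⊆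
        (strip T.toEquiv (E j) (min a b + 1) (h j - k) ∩ (B A ∆ (T.toEquiv^[k] ⁻¹' B A))) ∪
          ((A ∆ B A) ∪ (T.toEquiv^[k] ⁻¹' (A ∆ B A))) := by
      rintro x ⟨hx, hxA⟩
      simp only [Set.mem_union, Set.mem_inter_iff, Set.mem_symmDiff, Set.mem_preimage] at hxA ⊢
      tauto
    refine (measureReal_mono hsub (measure_ne_top _ _)).trans ((measureReal_union_le _ _).trans
      ((add_le_add_right (measureReal_union_le _ _) _).trans ?_))
    rw [T.measureReal_preimage_iterate k ((h𝒜 A hA).symmDiff (hB A hA).measurableSet)]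
    have := hAB A hA
    linarith

end RankOne

end ErgodicWH

namespace ErgodicWH

/-! ### The mass missed by the towers, and the aperiodic case. -/

section FixedPart

variable {X : Type*} [MeasurableSpace X] {μ : Measure X}

lemma IsRankOneSeq.tendsto_measureReal_base [IsProbabilityMeasure μ] {T : Automorphism μ}
    {E : ℕ → Set X} {h : ℕ → ℕ} (hT : IsRankOneSeq T E h) :
    Tendsto (fun j => μ.real (E j)) atTop (𝓝 0) := by
  refine squeeze_zero' (Eventually.of_forall fun j => measureReal_nonneg) ?_
    (tendsto_inv_atTop_nhds_zero_nat.comp hT.tendsto)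
  filter_upwards [hT.tendsto.eventually_gt_atTop 0] with j hj
  have := mul_measureReal_base_le_one (hT.tower j)
  rw [Function.comp_apply, ← one_div, le_div_iff₀ (by exact_mod_cast hj)]
  linarith

lemma IsRankOneSeq.eventually_notMem_strip [IsProbabilityMeasure μ] {T : Automorphism μ}
    {E : ℕ → Set X} {h : ℕ → ℕ} (hT : IsRankOneSeq T E h) {c : ℝ} (hc : 0 < c) :
    ∀ᶠ j in atTop, ∀ x, c ≤ μ.real {x} → x ∉ strip T.toEquiv (E j) 0 (h j) := by
  filter_upwards [hT.tendsto_measureReal_base.eventually_lt_const hc] with j hj x hx hxs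
  obtain ⟨i, -, -, hi⟩ := mem_strip.1 hxs
  have : μ.real {x} ≤ μ.real (T.toEquiv^[i] '' E j) :=
    measureReal_mono (Set.singleton_subset_iff.2 hi) (measure_ne_top _ _)
  rw [T.measureReal_level (hT.tower j).measurableSet] at this
  linarith

/-- Outer regularity gives each point a small open neighbourhood, second countability a countable
subcover, and continuity of measure a finite part of it. -/
lemma exists_finite_cover_of_measure_singleton_eq_zero [StandardBorelSpace X]
    [IsProbabilityMeasure μ] (hμ : ∀ x, μ {x} = 0) {ε : ℝ} (hε : 0 < ε) :
    ∃ (V : ℕ → Set X) (N : ℕ), (∀ n, MeasurableSet (V n)) ∧ (∀ n, μ.real (V n) ≤ ε) ∧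
      μ.real (⋃ n ∈ Finset.range N, V n)ᶜ ≤ ε := by
  let := upgradeStandardBorel X
  have hU : ∀ x : X, ∃ U, {x} ⊆ U ∧ IsOpen U ∧ μ U < ENNReal.ofReal ε := fun x =>
    Set.exists_isOpen_lt_of_lt {x} _ (by rw [hμ x]; simpa using hε)
  choose U hxU hUo hUε using hU
  obtain ⟨s, hs, hsU⟩ := TopologicalSpace.countable_cover_nhds fun x =>
    (hUo x).mem_nhds (hxU x rfl)
  have hne : s.Nonempty := by
    obtain ⟨x⟩ := nonempty_of_isProbabilityMeasure μ
    have hx : x ∈ ⋃ y ∈ s, U y := hsU ▸ Set.mem_univ x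
    simp only [Set.mem_iUnion] at hx
    obtain ⟨y, hy, -⟩ := hx
    exact ⟨y, hy⟩
  obtain ⟨f, rfl⟩ := hs.exists_eq_range hne
  rw [Set.biUnion_range] at hsU
  obtain ⟨N, hN⟩ := exists_measureReal_iUnion_sdiff_le (μ := μ) (V := fun n => U (f n))
    (fun n => (hUo _).measurableSet) hε
  rw [hsU, ← Set.compl_eq_univ_sdiff] at hN
  exact ⟨fun n => U (f n), N, fun n => (hUo _).measurableSet, fun n =>
    ENNReal.toReal_le_of_le_ofReal hε.le (hUε _).le, hN⟩

/-- Up to a part on which every automorphism is the identity (the whole mass of at most one atom),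
the towers of a rank one sequence exhaust the space. -/
theorem IsRankOneSeq.exists_fixed_part [StandardBorelSpace X] [IsProbabilityMeasure μ]
    {T : Automorphism μ} {E : ℕ → Set X} {h : ℕ → ℕ} (hT : IsRankOneSeq T E h) :
    ∃ D, MeasurableSet D ∧ (∀ S : Automorphism μ, ∀ x ∈ D, S.toEquiv x = x) ∧
      (∀ᶠ j in atTop, Disjoint D (strip T.toEquiv (E j) 0 (h j))) ∧
      ∀ ε : ℝ, 0 < ε → ∀ᶠ j in atTop, μ.real (strip T.toEquiv (E j) 0 (h j) ∪ D)ᶜ ≤ ε := by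
  by_cases hatom : ∃ x, μ {x} ≠ 0
  · obtain ⟨x, hx⟩ := hatom
    have hc : 0 < μ.real {x} := ENNReal.toReal_pos hx (measure_ne_top _ _)
    have hmem : ∀ B, μ.real ({x} ∆ B) < μ.real {x} → x ∈ B := by
      intro B hB
      by_contra hxB
      refine hB.not_ge (measureReal_mono ?_ (measure_ne_top _ _))
      rintro _ rfl
      exact Or.inl ⟨rfl, hxB⟩
    refine ⟨{x}, measurableSet_singleton x, ?_, ?_, fun ε hε => ?_⟩
    · intro S z hz
      rw [Set.mem_singleton_iff.1 hz]
      by_contra hSx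
      have hSμ : μ.real {S.toEquiv x} = μ.real {x} := by
        rw [← S.measurePreserving.measureReal_preimage
          (measurableSet_singleton _).nullMeasurableSet]
        congr 1
        ext y
        simp
      -- The atom x and its image have equal mass, so both lie in the remainder cell once levels are
      -- smaller than that mass. A union of cells approximating {x} would contain both.
      obtain ⟨j, hj, B, hB, hB'⟩ := ((hT.eventually_notMem_strip hc).and
        (hT.approx {x} (measurableSet_singleton x) _ hc)).exists
      have h1 := hB.rest x (hj x le_rfl) (S.toEquiv x) (hj _ hSμ.ge) (hmem B hB')
      refine hB'.not_ge (hSμ.ge.trans (measureReal_mono ?_ (measure_ne_top _ _)))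
      rintro _ rfl
      exact Or.inr ⟨h1, hSx⟩
    · filter_upwards [hT.eventually_notMem_strip hc] with j hj
      exact Set.disjoint_singleton_left.2 (hj x le_rfl)
    · filter_upwards [hT.eventually_notMem_strip hc, hT.approx {x} (measurableSet_singleton x) _
        (lt_min hε hc)] with j hj ⟨B, hB, hB'⟩
      refine le_trans (measureReal_mono ?_ (measure_ne_top _ _)) (hB'.le.trans (min_le_left _ _))
      intro y hy
      simp only [Set.mem_compl_iff, Set.mem_union, not_or] at hy
      exact Or.inr ⟨hB.rest x (hj x le_rfl) y hy.1 (hmem B (hB'.trans_le (min_le_right _ _))),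
        hy.2⟩
  · push Not at hatom
    refine ⟨∅, MeasurableSet.empty, fun _ _ hx => hx.elim, by simp, fun ε hε => ?_⟩
    obtain ⟨V, N, hV, hVε, hVN⟩ := exists_finite_cover_of_measure_singleton_eq_zero hatom
      (half_pos hε)
    filter_upwards [(Finset.eventually_all (Finset.range N)).2 fun n _ =>
      hT.approx (V n) (hV n) (ε / (2 * (N + 1))) (by positivity)] with j hj
    choose! B hB hB' using hj
    have hη : ε / (2 * (N + 1)) ≤ ε / 2 := by
      gcongr
      linarith [(Nat.cast_nonneg N : (0 : ℝ) ≤ N)]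
    rw [Set.union_empty]
    -- Either the remainder cell belongs to an approximant of a small set, or no approximant
    -- contains it and it essentially avoids the cover; it is small in both cases.
    by_cases hsub : ∃ n ∈ Finset.range N, (strip T.toEquiv (E j) 0 (h j))ᶜ ⊆ B n
    · obtain ⟨n, hn, hnB⟩ := hsub
      have hsub' : (strip T.toEquiv (E j) 0 (h j))ᶜ ⊆ V n ∪ (V n ∆ B n) := by
        intro y hy
        have := hnB hy
        simp only [Set.mem_union, Set.mem_symmDiff]
        tauto
      refine (measureReal_mono hsub' (measure_ne_top _ _)).trans ((measureReal_union_le _ _).trans ?_)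
      have h1 := hVε n
      have h2 := hB' n hn
      linarith
    · have hsub' : (strip T.toEquiv (E j) 0 (h j))ᶜ ⊆
          (⋃ n ∈ Finset.range N, V n)ᶜ ∪ ⋃ n ∈ Finset.range N, V n ∆ B n := by
        intro y hy
        by_cases hyV : y ∈ ⋃ n ∈ Finset.range N, V n
        · right
          simp only [Set.mem_iUnion] at hyV ⊢
          obtain ⟨n, hn, hyn⟩ := hyV
          exact ⟨n, hn, Or.inl ⟨hyn, fun hyB => hsub ⟨n, hn, fun z hz =>
            (hB n hn).rest y hy z hz hyB⟩⟩⟩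
        · exact Or.inl hyV
      refine (measureReal_mono hsub' (measure_ne_top _ _)).trans ((measureReal_union_le _ _).trans ?_)
      have h1 : μ.real (⋃ n ∈ Finset.range N, V n ∆ B n) ≤ N * (ε / (2 * (N + 1))) := by
        refine (measureReal_biUnion_finset_le _ _).trans ?_
        refine (Finset.sum_le_sum fun n hn => (hB' n hn).le).trans ?_
        simp
      have h2 : N * (ε / (2 * (N + 1))) ≤ ε / 2 := by
        rw [mul_div_assoc', div_le_div_iff₀ (by positivity) (by positivity)]
        nlinarith
      linarith

/-- Off the given strip, a point of the symmetric difference is in the lowest or highest q levels or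
outside both tower and D; T fixes D pointwise, so D contributes nothing. -/
lemma measureReal_symmDiff_preimage_le_of_strip [IsProbabilityMeasure μ] {T : Automorphism μ}
    {E : Set X} {h : ℕ} (hE : IsTower T.toEquiv E h) {D : Set X}
    (hD : ∀ x ∈ D, T.toEquiv x = x) (A : Set X) {u k q : ℕ} (hu : u ≤ q) (hk : k ≤ q) :
    μ.real (A ∆ (T.toEquiv^[k] ⁻¹' A)) ≤
      μ.real (strip T.toEquiv E u (h - k) ∩ (A ∆ (T.toEquiv^[k] ⁻¹' A))) + 2 * (q * μ.real E) +
        μ.real (strip T.toEquiv E 0 h ∪ D)ᶜ := by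
  rcases le_total h q with hq | hq
  · have : A ∆ (T.toEquiv^[k] ⁻¹' A) ⊆ strip T.toEquiv E 0 h ∪ (strip T.toEquiv E 0 h ∪ D)ᶜ := by
      intro x hx
      by_cases hxD : x ∈ D
      · have hfix := Function.iterate_fixed (hD x hxD) k
        simp only [Set.mem_symmDiff, Set.mem_preimage, hfix] at hx
        tauto
      · simp only [Set.mem_union, Set.mem_compl_iff]
        tauto
    refine (measureReal_mono this (measure_ne_top _ _)).trans ((measureReal_union_le _ _).trans ?_)
    gcongr
    rw [measureReal_strip hE le_rfl, Nat.sub_zero]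
    have h1 : (h : ℝ) * μ.real E ≤ q * μ.real E := by gcongr
    have h2 : 0 ≤ (h : ℝ) * μ.real E := by positivity
    have h3 : 0 ≤ μ.real (strip T.toEquiv E u (h - k) ∩ (A ∆ (T.toEquiv^[k] ⁻¹' A))) :=
      measureReal_nonneg
    linarith
  · have : A ∆ (T.toEquiv^[k] ⁻¹' A) ⊆
        (strip T.toEquiv E u (h - k) ∩ (A ∆ (T.toEquiv^[k] ⁻¹' A)) ∪
          (strip T.toEquiv E 0 q ∪ strip T.toEquiv E (h - q) h)) ∪
          (strip T.toEquiv E 0 h ∪ D)ᶜ := by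
      intro x hx
      by_cases hxD : x ∈ D
      · have hfix := Function.iterate_fixed (hD x hxD) k
        simp only [Set.mem_symmDiff, Set.mem_preimage, hfix] at hx
        tauto
      by_cases hxs : x ∈ strip T.toEquiv E 0 h
      · left
        obtain ⟨i, -, hi, hxi⟩ := mem_strip.1 hxs
        by_cases h1 : i < q
        · exact Or.inr (Or.inl (mem_strip.2 ⟨i, Nat.zero_le _, h1, hxi⟩))
        by_cases h2 : h - q ≤ i
        · exact Or.inr (Or.inr (mem_strip.2 ⟨i, h2, hi, hxi⟩))
        · exact Or.inl ⟨mem_strip.2 ⟨i, by omega, by omega, hxi⟩, hx⟩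
      · right
        simp only [Set.mem_union, Set.mem_compl_iff]
        tauto
    refine (measureReal_mono this (measure_ne_top _ _)).trans ((measureReal_union_le _ _).trans ?_)
    gcongr
    refine (measureReal_union_le _ _).trans ?_
    gcongr
    refine (measureReal_union_le _ _).trans ?_
    rw [measureReal_strip hE hq, measureReal_strip hE le_rfl, Nat.sub_zero, Nat.sub_sub_self hq]
    linarith

/-- A rank one automorphism with an aperiodic weakly homoclinic automorphism is approximately
periodic. -/
theorem IsRankOneSeq.approxPeriodic_of_isAperiodic [StandardBorelSpace X] [IsProbabilityMeasure μ]
    {T : Automorphism μ} {E : ℕ → Set X} {h : ℕ → ℕ} (hT : IsRankOneSeq T E h)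
    {S : Automorphism μ} (hS : S ∈ weaklyHomoclinic T) (hap : S.IsAperiodic) :
    T.ApproxPeriodic := by
  intro 𝒜 h𝒜 ε hε
  obtain ⟨D, hDm, hDfix, -, hDrest⟩ := hT.exists_fixed_part
  have hDnull : μ.real D = 0 := by
    rw [measureReal_eq_zero_iff]
    refine measure_mono_null (fun x hx => ?_) (ae_iff.1 hap)
    simp only [Set.mem_ofPred_eq, not_forall]
    exact ⟨1, one_pos, fun h' => h' (hDfix S x hx)⟩
  obtain ⟨K, hK⟩ := exists_nat_gt (4 / ε)
  have hK0 : (0 : ℝ) < K := lt_trans (by positivity) hK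
  have hKn : 0 < K := by exact_mod_cast hK0
  have hKε : 2 * (1 / (K : ℝ)) ≤ ε / 2 := by
    rw [div_lt_iff₀ hε] at hK
    rw [mul_one_div, div_le_div_iff₀ hK0 two_pos]
    linarith
  -- The bottom strip will have measure at least 3/(4K) and lose at most 2Kδ to exceptional points;
  -- then 2K times the rest is at least 3/2 - 4K²δ > 1, as recurrence requires.
  have hδ : 0 < min (ε / 4) (1 / (16 * (K : ℝ) ^ 2)) := by positivity
  set δ := min (ε / 4) (1 / (16 * (K : ℝ) ^ 2)) with hδdef
  have hδε : δ ≤ ε / 4 := min_le_left _ _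
  have hδK : (K : ℝ) ^ 2 * δ ≤ 1 / 16 := by
    have : δ ≤ 1 / (16 * (K : ℝ) ^ 2) := min_le_right _ _
    rw [le_div_iff₀ (by positivity)] at this
    linarith
  have hρ : 0 < min (ε / 4) (1 / 8) := by positivity
  have hRfix := asympFixed_of_mem_weaklyHomoclinic hS
  have hev := (Finset.eventually_all (Finset.range (2 * K))).2 fun m _ =>
    hT.eventually_exists_exceptional (S.measurePreserving.iterate m)
      (hRfix.iterate T.toEquiv.measurable S.measurePreserving m) 𝒜 h𝒜 hδ
  obtain ⟨j, hjZ, hjrest, hjE⟩ := (hev.and ((hDrest _ hρ).and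
    (hT.tendsto_measureReal_base.eventually_lt_const
      (show (0 : ℝ) < 1 / (8 * K) by positivity)))).exists
  choose! Z hZm hZδ hZ using hjZ
  have hE := hT.tower j
  set q := h j / K with hq
  have hqK : K * q ≤ h j := Nat.mul_div_le _ _
  have hqK' : h j ≤ K * q + K := by
    have := Nat.lt_mul_div_succ (h j) hKn
    rw [mul_add, mul_one] at this
    exact this.le
  have hE0 : 0 ≤ μ.real (E j) := measureReal_nonneg
  have hhE := mul_measureReal_base_le_one hE
  have hqE : (q : ℝ) * μ.real (E j) ≤ 1 / K := by
    rw [le_div_iff₀ hK0]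
    have : ((K * q : ℕ) : ℝ) * μ.real (E j) ≤ h j * μ.real (E j) := by gcongr
    push_cast at this
    linarith
  have hhE' : 1 - min (ε / 4) (1 / 8) ≤ h j * μ.real (E j) := by
    have h1 := measureReal_strip hE (u := 0) le_rfl
    rw [Nat.sub_zero] at h1
    have h2 : μ.real (strip T.toEquiv (E j) 0 (h j) ∪ D) ≤ h j * μ.real (E j) := by
      refine (measureReal_union_le _ _).trans ?_
      rw [h1, hDnull, add_zero]
    have h3 := probReal_compl_eq_one_sub (μ := μ)
      ((T.measurableSet_strip hE.measurableSet 0 (h j)).union hDm)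
    linarith
  have hKE : (K : ℝ) * μ.real (E j) ≤ 1 / 8 := by
    rw [lt_div_iff₀ (by positivity)] at hjE
    linarith
  have hqE' : 3 / 4 ≤ K * (q * μ.real (E j)) := by
    have : (h j : ℝ) * μ.real (E j) ≤ ((K * q + K : ℕ) : ℝ) * μ.real (E j) := by gcongr
    push_cast at this
    have h8 : min (ε / 4) (1 / 8) ≤ 1 / 8 := min_le_right _ _
    linarith
  let N := toMeasurable μ {x | ¬ ∀ n : ℕ, 0 < n → S.toEquiv^[n] x ≠ x}
  have hN : μ.real N = 0 := by
    rw [measureReal_eq_zero_iff, measure_toMeasurable]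
    exact ae_iff.1 hap
  let L := strip T.toEquiv (E j) 0 q \ ((⋃ m ∈ Finset.range (2 * K), Z m) ∪ N)
  have hLm : MeasurableSet L := (T.measurableSet_strip hE.measurableSet 0 q).diff
    ((Finset.measurableSet_biUnion _ hZm).union (measurableSet_toMeasurable _ _))
  have hL : q * μ.real (E j) - 2 * K * δ ≤ μ.real L := by
    have h1 := measureReal_strip hE (u := 0) ((Nat.div_le_self (h j) K))
    rw [Nat.sub_zero, ← hq] at h1
    have h2 : μ.real ((⋃ m ∈ Finset.range (2 * K), Z m) ∪ N) ≤ 2 * K * δ := by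
      refine (measureReal_union_le _ _).trans ?_
      rw [hN, add_zero]
      refine (measureReal_biUnion_finset_le _ _).trans ((Finset.sum_le_sum hZδ).trans ?_)
      simp
    have h3 := le_measureReal_sdiff (μ := μ) (s₂ := (⋃ m ∈ Finset.range (2 * K), Z m) ∪ N)
      (s₁ := strip T.toEquiv (E j) 0 q)
    linarith
  have hvol : μ Set.univ < (2 * K : ℕ) * μ L := by
    have hreal : (1 : ℝ) < (2 * K : ℕ) * μ.real L := by
      push_cast
      nlinarith
    rw [measure_univ, ← ENNReal.toReal_lt_toReal ENNReal.one_ne_top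
      (ENNReal.mul_ne_top (ENNReal.natCast_ne_top _) (measure_ne_top _ _)), ENNReal.toReal_mul,
      ENNReal.toReal_one, ENNReal.toReal_natCast]
    exact hreal
  -- Recurrence within 2K steps puts x and S^m x both in the bottom strip, so their level distance
  -- is below q.
  obtain ⟨x, hxL, m, ⟨hm0, hmK⟩, hmx⟩ :=
    S.measurePreserving.exists_mem_iterate_mem_of_measure_univ_lt_mul_measure
      hLm.nullMeasurableSet hvol
  simp only [L, Set.mem_sdiff, Set.mem_union, Set.mem_iUnion, not_or, not_exists] at hxL hmx
  obtain ⟨a, -, haq, hxa⟩ := mem_strip.1 hxL.1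
  obtain ⟨b, -, hbq, hxb⟩ := mem_strip.1 hmx.1
  have hqh : q ≤ h j := Nat.div_le_self _ _
  obtain ⟨hsep, hper⟩ := hZ m (Finset.mem_range.2 hmK) x (hxL.2.1 m (Finset.mem_range.2 hmK))
  have hxap : ∀ n : ℕ, 0 < n → S.toEquiv^[n] x ≠ x := by
    by_contra hcon
    exact hxL.2.2 (subset_toMeasurable _ _ hcon)
  have hab : a ≠ b := by
    rintro rfl
    exact hsep (hxap m hm0) a (haq.trans_le hqh) hxa hxb
  refine ⟨max a b - min a b, by omega, fun A hA => ?_⟩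
  have h1 := hper 0 (Nat.zero_le _) a b hxa hxb A hA
  have h2 := measureReal_symmDiff_preimage_le_of_strip hE (hDfix T) A
    (show min a b + 1 ≤ q by omega) (show max a b - min a b ≤ q by omega)
  have h3 : min (ε / 4) (1 / 8) ≤ ε / 4 := min_le_left _ _
  linarith

end FixedPart

end ErgodicWH

namespace ErgodicWH

/-! ### Equidistribution of sets along the towers. -/

section Equidistribution

variable {X : Type*} [MeasurableSpace X] {μ : Measure X}

lemma abs_measureReal_sub_le_symmDiff [IsFiniteMeasure μ] {A B : Set X} (hA : MeasurableSet A)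
    (hB : MeasurableSet B) : |μ.real A - μ.real B| ≤ μ.real (A ∆ B) := by
  have h1 := measureReal_inter_add_sdiff (μ := μ) (s := A) hB
  have h2 := measureReal_inter_add_sdiff (μ := μ) (s := B) hA
  rw [Set.inter_comm] at h2
  rw [measureReal_symmDiff_eq hA hB, abs_le]
  have h3 : 0 ≤ μ.real (A \ B) := measureReal_nonneg
  have h4 : 0 ≤ μ.real (B \ A) := measureReal_nonneg
  constructor <;> linarith

lemma abs_measureReal_inter_sub_le_symmDiff [IsFiniteMeasure μ] {A B W : Set X}
    (hA : MeasurableSet A) (hB : MeasurableSet B) (hW : MeasurableSet W) :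
    |μ.real (A ∩ W) - μ.real (B ∩ W)| ≤ μ.real (A ∆ B) := by
  refine (abs_measureReal_sub_le_symmDiff (hA.inter hW) (hB.inter hW)).trans
    (measureReal_mono ?_ (measure_ne_top _ _))
  intro x hx
  simp only [Set.mem_symmDiff, Set.mem_inter_iff] at hx ⊢
  tauto

/-- Only the two ends matter: a point leaves the strip from its top level or enters it at its bottom
level. -/
lemma measureReal_strip_symmDiff_preimage_le [IsFiniteMeasure μ] (T : Automorphism μ)
    {E : Set X} (hE : MeasurableSet E) (u v : ℕ) :
    μ.real (strip T.toEquiv E u v ∆ (T.toEquiv ⁻¹' strip T.toEquiv E u v)) ≤ 2 * μ.real E := by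
  have hsub : strip T.toEquiv E u v ∆ (T.toEquiv ⁻¹' strip T.toEquiv E u v) ⊆
      (T.toEquiv^[v - 1] '' E) ∪ (T.toEquiv^[1] ⁻¹' (T.toEquiv^[u] '' E)) := by
    rintro x (⟨hx, hx'⟩ | ⟨hx, hx'⟩)
    · left
      obtain ⟨i, h1, h2, h3⟩ := mem_strip.1 hx
      have : ¬ i + 1 < v := fun hlt => hx' (mem_strip.2 ⟨1 + i, by omega, by omega,
        iterate_mem_level 1 h3⟩)
      rwa [show v - 1 = i by omega]
    · right
      obtain ⟨i, h1, h2, h3⟩ := mem_strip.1 hx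
      rcases h1.eq_or_lt with rfl | hlt
      · exact h3
      · refine absurd (mem_strip.2 ⟨i - 1, by omega, by omega, ?_⟩) hx'
        refine mem_level_of_iterate_mem T.toEquiv.injective (n := 1) ?_
        rwa [show 1 + (i - 1) = i by omega]
  refine (measureReal_mono hsub (measure_ne_top _ _)).trans ((measureReal_union_le _ _).trans ?_)
  rw [T.measureReal_preimage_iterate 1 (T.measurableSet_level hE u), T.measureReal_level hE,
    T.measureReal_level hE]
  linarith

lemma abs_measureReal_level_inter_sub_le [IsFiniteMeasure μ] (T : Automorphism μ)
    {F : Set X} (hF : MeasurableSet F) {W : Set X} (hW : MeasurableSet W) {c : ℝ}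
    (hc : μ.real (W ∆ (T.toEquiv ⁻¹' W)) ≤ c) (i : ℕ) :
    |μ.real (T.toEquiv^[i] '' F ∩ W) - μ.real (F ∩ W)| ≤ i * c := by
  rw [← T.measureReal_preimage_iterate i ((T.measurableSet_level hF i).inter hW),
    Set.preimage_inter, (T.toEquiv.injective.iterate i).preimage_image, Set.inter_comm F,
    Set.inter_comm F]
  refine (abs_measureReal_inter_sub_le_symmDiff (T.measurableSet_preimage_iterate i hW) hW
    hF).trans ?_
  rw [symmDiff_comm]
  refine (measureReal_symmDiff_preimage_iterate_le T.measurePreserving hW i).trans ?_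
  gcongr

/-- An almost invariant set `W` cuts all unions of levels of a tower in nearly the same
proportion. -/
lemma abs_measureReal_biUnion_levels_inter_sub_le [IsFiniteMeasure μ] {T : Automorphism μ}
    {F : Set X} {h : ℕ} (hF : IsTower T.toEquiv F h) {W : Set X} (hW : MeasurableSet W) {c : ℝ}
    (hc : μ.real (W ∆ (T.toEquiv ⁻¹' W)) ≤ c) {I : Finset ℕ} (hI : ∀ i ∈ I, i < h) :
    |μ.real ((⋃ i ∈ I, T.toEquiv^[i] '' F) ∩ W) - I.card * μ.real (F ∩ W)| ≤ h * (h * c) := by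
  have hc0 : 0 ≤ c := measureReal_nonneg.trans hc
  have hsum : μ.real ((⋃ i ∈ I, T.toEquiv^[i] '' F) ∩ W) =
      ∑ i ∈ I, μ.real (T.toEquiv^[i] '' F ∩ W) := by
    rw [Set.iUnion₂_inter, measureReal_biUnion_finset]
    · intro a ha b hb hab
      exact (hF.disjoint a (hI a ha) b (hI b hb) hab).mono Set.inter_subset_left
        Set.inter_subset_left
    · exact fun i _ => (T.measurableSet_level hF.measurableSet i).inter hW
  rw [hsum, ← nsmul_eq_mul, ← Finset.sum_const, ← Finset.sum_sub_distrib]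
  refine (Finset.abs_sum_le_sum_abs _ _).trans ?_
  have hterm : ∀ i ∈ I, |μ.real (T.toEquiv^[i] '' F ∩ W) - μ.real (F ∩ W)| ≤ h * c := by
    intro i hi
    refine (abs_measureReal_level_inter_sub_le T hF.measurableSet hW hc i).trans ?_
    have : (i : ℝ) ≤ h := by exact_mod_cast (hI i hi).le
    gcongr
  refine (Finset.sum_le_sum hterm).trans ?_
  rw [Finset.sum_const, nsmul_eq_mul]
  have hcard : (I.card : ℝ) ≤ h := by
    have : I ⊆ Finset.range h := fun i hi => Finset.mem_range.2 (hI i hi)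
    exact_mod_cast (Finset.card_le_card this).trans_eq (Finset.card_range h)
  gcongr

lemma abs_mul_sub_mul_le {x y x' y' : ℝ} (hy0 : 0 ≤ y) (hy1 : y ≤ 1) (hx0 : 0 ≤ x')
    (hx1 : x' ≤ 1) : |x * y - x' * y'| ≤ |x - x'| + |y - y'| := by
  have : x * y - x' * y' = (x - x') * y + x' * (y - y') := by ring
  rw [this]
  refine (abs_add_le _ _).trans ?_
  rw [abs_mul, abs_mul, abs_of_nonneg hy0, abs_of_nonneg hx0]
  gcongr
  · exact mul_le_of_le_one_right (abs_nonneg _) hy1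
  · exact mul_le_of_le_one_left (abs_nonneg _) hx1

/-- Every set outside the fixed part is equidistributed along the towers. -/
theorem IsRankOneSeq.eventually_equidistributed [IsProbabilityMeasure μ] {T : Automorphism μ}
    {E : ℕ → Set X} {h : ℕ → ℕ} (hT : IsRankOneSeq T E h) {D : Set X} (hDm : MeasurableSet D)
    (hDdisj : ∀ᶠ j in atTop, Disjoint D (strip T.toEquiv (E j) 0 (h j)))
    (hDrest : ∀ ε : ℝ, 0 < ε → ∀ᶠ j in atTop, μ.real (strip T.toEquiv (E j) 0 (h j) ∪ D)ᶜ ≤ ε)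
    {A : Set X} (hA : MeasurableSet A) (hAD : Disjoint A D) {δ : ℝ} (hδ : 0 < δ) :
    ∀ᶠ j in atTop, ∀ u v, v ≤ h j → |μ.real (A ∩ strip T.toEquiv (E j) u v) * μ.real Dᶜ -
      μ.real A * μ.real (strip T.toEquiv (E j) u v)| ≤ δ := by
  classical
  have hη : 0 < δ / 12 := by positivity
  -- One coarse tower approximating A is frozen. Strips W of much later towers are almost
  -- T-invariant, so they meet all its levels in nearly equal measure.
  obtain ⟨j₀, hdisj₀, hrest₀, B, hB, hAB⟩ :=
    (hDdisj.and ((hDrest _ hη).and (hT.approx A hA _ hη))).exists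
  have hF := hT.tower j₀
  set F := E j₀
  set h₀ := h j₀
  let I := (Finset.range h₀).filter fun i => ∃ x ∈ T.toEquiv^[i] '' F, x ∈ B
  have hI : ∀ i ∈ I, i < h₀ := fun i hi => Finset.mem_range.1 (Finset.mem_filter.1 hi).1
  set B' := ⋃ i ∈ I, T.toEquiv^[i] '' F with hB'def
  have hB'm : MeasurableSet B' := Finset.measurableSet_biUnion _ fun i _ =>
    T.measurableSet_level hF.measurableSet i
  have hAB' : μ.real (A ∆ B') ≤ 2 * (δ / 12) := by
    have hsub : A ∆ B' ⊆ (A ∆ B) ∪ (strip T.toEquiv F 0 h₀ ∪ D)ᶜ := by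
      rintro x (⟨hx, hx'⟩ | ⟨hx, hx'⟩)
      · by_cases hxs : x ∈ strip T.toEquiv F 0 h₀
        · left
          refine Or.inl ⟨hx, fun hxB => hx' ?_⟩
          obtain ⟨i, -, hi, hxi⟩ := mem_strip.1 hxs
          simp only [hB'def, Set.mem_iUnion]
          exact ⟨i, Finset.mem_filter.2 ⟨Finset.mem_range.2 hi, x, hxi, hxB⟩, hxi⟩
        · exact Or.inr fun hx'' => hx''.elim hxs (Set.disjoint_left.1 hAD hx)
      · left
        simp only [hB'def, Set.mem_iUnion] at hx
        obtain ⟨i, hi, hxi⟩ := hx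
        obtain ⟨hi1, y, hyi, hyB⟩ := Finset.mem_filter.1 hi
        exact Or.inr ⟨hB.level i (Finset.mem_range.1 hi1) y hyi x hxi hyB, hx'⟩
    refine (measureReal_mono hsub (measure_ne_top _ _)).trans ((measureReal_union_le _ _).trans ?_)
    linarith
  have hsm := T.measurableSet_strip hF.measurableSet 0 h₀
  have hc : 0 < δ / (8 * (h₀ * h₀ + 1)) := by positivity
  filter_upwards [hDdisj, hT.tendsto_measureReal_base.eventually_lt_const hc] with j hdisj hEj u v hv
  have hW := T.measurableSet_strip (hT.tower j).measurableSet u v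
  have hWinv := measureReal_strip_symmDiff_preimage_le T (hT.tower j).measurableSet u v
  have hWD : Disjoint D (strip T.toEquiv (E j) u v) :=
    hdisj.mono_right (strip_mono (Nat.zero_le _) hv)
  set W := strip T.toEquiv (E j) u v
  have hθ : (h₀ : ℝ) * (h₀ * (2 * μ.real (E j))) ≤ δ / 4 := by
    rw [lt_div_iff₀ (by positivity)] at hEj
    have : 0 ≤ μ.real (E j) := measureReal_nonneg
    linarith
  -- With e = μ(F), the measures of A ∩ W, Dᶜ, A and W are close to |I|w, h₀e, |I|e and h₀w, so both
  -- products are close to |I|h₀we. The four errors are 5, 1, 2 and 4 twelfths of δ.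
  set w := μ.real (F ∩ W)
  set e := μ.real F
  have hw0 : 0 ≤ w := measureReal_nonneg
  have he0 : 0 ≤ e := measureReal_nonneg
  have hwe : w ≤ e := measureReal_mono Set.inter_subset_left (measure_ne_top _ _)
  have hhe : h₀ * e ≤ 1 := mul_measureReal_base_le_one hF
  have hIcard : (I.card : ℝ) ≤ h₀ := by
    exact_mod_cast (Finset.card_le_card (Finset.filter_subset _ _)).trans_eq (Finset.card_range h₀)
  have hIe : I.card * e ≤ 1 := (mul_le_mul_of_nonneg_right hIcard he0).trans hhe
  have hIw : I.card * w ≤ 1 :=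
    (mul_le_mul_of_nonneg_left hwe (Nat.cast_nonneg _)).trans hIe
  have b1 : |μ.real (A ∩ W) - I.card * w| ≤ 2 * (δ / 12) + δ / 4 := by
    have t1 := abs_measureReal_inter_sub_le_symmDiff (μ := μ) hA hB'm hW
    have t2 := abs_measureReal_biUnion_levels_inter_sub_le hF hW hWinv hI
    have t3 := abs_sub_le (μ.real (A ∩ W)) (μ.real (B' ∩ W)) (I.card * w)
    linarith
  have b2 : |μ.real Dᶜ - h₀ * e| ≤ δ / 12 := by
    have t1 := abs_measureReal_sub_le_symmDiff (μ := μ) hDm.compl hsm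
    rw [measureReal_strip hF le_rfl, Nat.sub_zero] at t1
    refine t1.trans (le_trans (measureReal_mono ?_ (measure_ne_top _ _)) hrest₀)
    rintro x (⟨hx, hx'⟩ | ⟨hx, hx'⟩)
    · exact fun hx'' => hx''.elim hx' hx
    · exact absurd hx (Set.disjoint_left.1 hdisj₀ (not_not.1 hx'))
  have b3 : |μ.real A - I.card * e| ≤ 2 * (δ / 12) := by
    have t1 := abs_measureReal_sub_le_symmDiff (μ := μ) hA hB'm
    rw [hB'def, measureReal_biUnion_levels hF hI] at t1
    exact t1.trans hAB'
  have b4 : |μ.real W - h₀ * w| ≤ δ / 12 + δ / 4 := by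
    have t1 : |μ.real W - μ.real (strip T.toEquiv F 0 h₀ ∩ W)| ≤ δ / 12 := by
      refine (abs_measureReal_sub_le_symmDiff hW (hsm.inter hW)).trans
        (le_trans (measureReal_mono ?_ (measure_ne_top _ _)) hrest₀)
      rintro x (⟨hx, hx'⟩ | ⟨hx, hx'⟩)
      · exact fun hx'' => hx''.elim (fun hs => hx' ⟨hs, hx⟩)
          (fun hxD => Set.disjoint_left.1 hWD hxD hx)
      · exact absurd hx.2 hx'
    have t2 := abs_measureReal_biUnion_levels_inter_sub_le hF hW hWinv (I := Finset.Ico 0 h₀)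
      fun i hi => (Finset.mem_Ico.1 hi).2
    rw [Nat.card_Ico, Nat.sub_zero] at t2
    have t3 := abs_sub_le (μ.real W) (μ.real (strip T.toEquiv F 0 h₀ ∩ W)) (h₀ * w)
    unfold strip at t1 t3
    linarith
  have c1 := abs_mul_sub_mul_le (x := μ.real (A ∩ W)) (y' := h₀ * e)
    (measureReal_nonneg (μ := μ) (s := Dᶜ)) measureReal_le_one
    (mul_nonneg (Nat.cast_nonneg I.card) hw0) hIw
  have c2 := abs_mul_sub_mul_le (x := μ.real A) (y' := h₀ * w)
    (measureReal_nonneg (μ := μ) (s := W)) measureReal_le_one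
    (mul_nonneg (Nat.cast_nonneg I.card) he0) hIe
  have c3 := abs_sub_le (μ.real (A ∩ W) * μ.real Dᶜ) (I.card * w * (h₀ * e)) (μ.real A * μ.real W)
  rw [abs_sub_comm (I.card * w * (h₀ * e)),
    show (I.card : ℝ) * w * (h₀ * e) = I.card * e * (h₀ * w) by ring] at c3
  rw [show (I.card : ℝ) * w * (h₀ * e) = I.card * e * (h₀ * w) by ring] at c1
  linarith

end Equidistribution

/-! ### Waiting until two orbits are at most about half a tower apart. -/

section Climb

variable {X : Type*}

/-- If `y` is near the bottom of a tower, then at some time `y` and `z` are on levels whose distance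
is about half of the height at most, and one of them is near the bottom. -/
lemma exists_time_of_strip {T : X → X} (hTi : Function.Injective T) {E : Set X} {h κ q : ℕ}
    (hE : ∀ a < h, ∀ b < h, a ≠ b → Disjoint (T^[a] '' E) (T^[b] '' E)) (hq : 2 * κ * q ≤ h)
    {y z : X} (hy : y ∈ strip T E 0 q)
    (hz : ∀ p ≤ 2 * κ, T^[p * q] z ∈ strip T E 0 (2 * κ * q))
    (hyz : ∀ i < h, y ∈ T^[i] '' E → z ∉ T^[i] '' E) :
    ∃ n a b, n ≤ h ∧ T^[n] y ∈ T^[a] '' E ∧ T^[n] z ∈ T^[b] '' E ∧ a ≠ b ∧ min a b < q ∧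
      max a b - min a b ≤ (κ + 1) * q := by
  obtain ⟨a, -, haq, hya⟩ := mem_strip.1 hy
  have hz0 := hz 0 (Nat.zero_le _)
  rw [Nat.zero_mul] at hz0
  obtain ⟨b, -, hbq, hzb⟩ := mem_strip.1 hz0
  have hq0 : 0 < q := by omega
  have hκ : 0 < κ := by
    rcases Nat.eq_zero_or_pos κ with rfl | h'
    · simp at hbq
    · exact h'
  have hqh : q ≤ h := by nlinarith
  by_cases hb : b < (κ + 1) * q
  · refine ⟨0, a, b, Nat.zero_le _, hya, hzb, ?_, by omega, ?_⟩
    · rintro rfl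
      exact hyz a (haq.trans_le hqh) hya hzb
    · have : q ≤ (κ + 1) * q := Nat.le_mul_of_pos_left _ (Nat.succ_pos _)
      omega
  · have hp1 : κ + 1 ≤ b / q := (Nat.le_div_iff_mul_le hq0).2 (not_lt.1 hb)
    have hp2 : b / q < 2 * κ := (Nat.div_lt_iff_lt_mul hq0).2 hbq
    -- At time rq the point z is still in the tower; q steps later it would have climbed to level
    -- 2κq or above.
    obtain ⟨r, hr⟩ : ∃ r, 2 * κ = b / q + 1 + r := ⟨2 * κ - b / q - 1, by omega⟩
    have hbp : b / q * q ≤ b := Nat.div_mul_le_self b q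
    have e1 : 2 * κ * q = b / q * q + q + r * q := by rw [hr]; ring
    have e2 : (r + 1) * q = r * q + q := by ring
    obtain ⟨c, -, hc, hzc⟩ := mem_strip.1 (hz (r + 1) (by omega))
    have hzr : T^[r * q] z ∈ T^[r * q + b] '' E := iterate_mem_level _ hzb
    -- By hypothesis z is again below level 2κq. Were c ≥ q, stepping back q times would put z on
    -- level c - q, which disjointness of levels excludes.
    have hcq : c < q := by
      by_contra hcon
      have h1 : T^[q] (T^[r * q] z) ∈ T^[q + (c - q)] '' E := by
        rw [← Function.iterate_add_apply, show q + (c - q) = c by omega,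
          show q + r * q = (r + 1) * q by ring]
        exact hzc
      have h2 := mem_level_of_iterate_mem hTi h1
      have hbr : r * q + b < h := by
        have := Nat.lt_div_mul_add (a := b) hq0
        omega
      refine Set.disjoint_left.1 (hE (c - q) (by omega) (r * q + b) hbr ?_) h2 hzr
      omega
    have e3 : (r + 1) * q + q ≤ κ * q := by
      rw [← Nat.succ_mul]
      exact Nat.mul_le_mul_right q (by omega)
    have e4 : (κ + 1) * q = κ * q + q := by ring
    refine ⟨(r + 1) * q, (r + 1) * q + a, c, by omega, iterate_mem_level _ hya, hzc, by omega,
      by omega, by omega⟩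

/-- Arithmetic of the final count: a strip of κ - 2 blocks out of 2κ has share 1/2 - 1/κ of the mass
Y, and `hw` transfers this share to a set of measure s meeting the strip in measure w. -/
lemma half_sub_le_of_mul_le {κ β Y δ ε s w : ℝ} (hκ0 : 0 < κ) (hκ2 : 2 ≤ κ)
    (hκε : 1 / κ ≤ ε / 4) (hβ : Y - 2 * δ ≤ 2 * κ * β) (hw : s * ((κ - 2) * β) ≤ w * Y + δ)
    (hs0 : 0 ≤ s) (hs1 : s ≤ 1) (hY0 : 0 < Y) (hδY : 12 * δ ≤ Y * ε) (hδ : 0 < δ) :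
    s / 2 - 3 * (ε / 4) ≤ w := by
  have h1 : (1 / 2 - 1 / κ) * (Y - 2 * δ) ≤ (κ - 2) * β := by
    have : 1 / 2 - 1 / κ = (κ - 2) / (2 * κ) := by field_simp
    rw [this, div_mul_eq_mul_div, div_le_iff₀ (by positivity)]
    linarith [mul_le_mul_of_nonneg_left hβ (sub_nonneg.2 hκ2)]
  have h2 : Y / 2 - Y * (ε / 4) - δ ≤ (κ - 2) * β := by
    have e1 : Y * (1 / κ) ≤ Y * (ε / 4) := by gcongr
    have e2 : 0 ≤ δ * (1 / κ) := by positivity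
    linarith
  have h3 : s * (Y / 2 - Y * (ε / 4) - δ) ≤ w * Y + δ :=
    (mul_le_mul_of_nonneg_left h2 hs0).trans hw
  have h4 : s * (Y * (ε / 4) + δ) ≤ Y * (ε / 4) + δ :=
    mul_le_of_le_one_left (by linarith) hs1
  refine le_of_mul_le_mul_right ?_ hY0
  linarith

end Climb

/-! ### The nontrivial case: half returns. -/

section NontrivialHomoclinic

variable {X : Type*} [MeasurableSpace X] {μ : Measure X}

/-- A rank one automorphism with a nontrivial weakly homoclinic automorphism has large times at
which sets return to themselves with probability almost `1 / 2`. -/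
theorem IsRankOneSeq.halfReturning_of_not_isTrivial [StandardBorelSpace X] [IsProbabilityMeasure μ]
    {T : Automorphism μ} {E : ℕ → Set X} {h : ℕ → ℕ} (hT : IsRankOneSeq T E h)
    {S : Automorphism μ} (hS : S ∈ weaklyHomoclinic T) (hSne : ¬ S.IsTrivial) :
    T.HalfReturning := by
  classical
  by_cases hper : T.ApproxPeriodic
  · exact hper.halfReturning
  -- A family with no approximate period is carried along with 𝒜; it will force the return time to
  -- be large.
  obtain ⟨𝒜₀, h𝒜₀, ε₀, hε₀, hnp⟩ : ∃ 𝒜₀ : Finset (Set X), (∀ A ∈ 𝒜₀, MeasurableSet A) ∧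
      ∃ ε₀ : ℝ, 0 < ε₀ ∧ ∀ k : ℕ, 0 < k → ∃ A ∈ 𝒜₀,
        ε₀ < μ.real (A ∆ (T.toEquiv^[k] ⁻¹' A)) := by
    unfold Automorphism.ApproxPeriodic at hper
    push Not at hper
    exact hper
  intro 𝒜 h𝒜 ε hε M
  obtain ⟨D, hDm, hDfix, hDdisj, hDrest⟩ := hT.exists_fixed_part
  have hA₀m : MeasurableSet {y | S.toEquiv y ≠ y} :=
    (measurableSet_eq_fun S.toEquiv.measurable measurable_id).compl
  have hα : 0 < μ.real {y | S.toEquiv y ≠ y} :=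
    ENNReal.toReal_pos (fun h0 => hSne (ae_iff.2 h0)) (measure_ne_top _ _)
  have hA₀D : Disjoint {y | S.toEquiv y ≠ y} D :=
    Set.disjoint_left.2 fun y hy hyD => hy (hDfix S y hyD)
  set A₀ := {y | S.toEquiv y ≠ y} with hA₀def
  set α := μ.real A₀ with hαdef
  have hα1 : α ≤ 1 := measureReal_le_one
  have hαY : α ≤ μ.real Dᶜ :=
    measureReal_mono hA₀D.subset_compl_right (measure_ne_top _ _)
  set Y := μ.real Dᶜ with hYdef
  have hY1 : Y ≤ 1 := measureReal_le_one
  have hY0 : 0 < Y := hα.trans_le hαY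
  obtain ⟨κ, hκ⟩ := exists_nat_gt (max 3 (max (4 / ε) (4 / ε₀)))
  have hκ3 : (3 : ℝ) < κ := (le_max_left _ _).trans_lt hκ
  have hκ0 : (0 : ℝ) < κ := by linarith
  have hκε : 1 / (κ : ℝ) ≤ ε / 4 := by
    have := ((le_max_left _ _).trans (le_max_right _ _)).trans_lt hκ
    rw [div_lt_iff₀ hε] at this
    rw [div_le_div_iff₀ hκ0 (by norm_num)]
    linarith
  have hκε₀ : 1 / (κ : ℝ) ≤ ε₀ / 4 := by
    have := ((le_max_right _ _).trans (le_max_right _ _)).trans_lt hκ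
    rw [div_lt_iff₀ hε₀] at this
    rw [div_le_div_iff₀ hκ0 (by norm_num)]
    linarith
  obtain ⟨δ, hδ, hδε, hδε₀, hδα⟩ : ∃ δ : ℝ, 0 < δ ∧ 12 * δ ≤ α * ε ∧ 4 * δ ≤ ε₀ ∧
      100 * κ ^ 2 * δ ≤ α ^ 2 := by
    refine ⟨min (α * ε / 12) (min (ε₀ / 4) (α ^ 2 / (100 * κ ^ 2))), by positivity, ?_, ?_, ?_⟩
    · linarith [min_le_left (α * ε / 12) (min (ε₀ / 4) (α ^ 2 / (100 * κ ^ 2)))]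
    · linarith [(min_le_right (α * ε / 12) (min (ε₀ / 4) (α ^ 2 / (100 * κ ^ 2)))).trans
        (min_le_left _ _)]
    · have := (min_le_right (α * ε / 12) (min (ε₀ / 4) (α ^ 2 / (100 * κ ^ 2)))).trans
        (min_le_right _ _)
      rw [le_div_iff₀ (by positivity)] at this
      linarith
  have hκn : 0 < κ := by exact_mod_cast hκ0
  have hall : ∀ A ∈ 𝒜 ∪ 𝒜₀, MeasurableSet A := fun A hA =>
    (Finset.mem_union.1 hA).elim (h𝒜 A) (h𝒜₀ A)
  obtain ⟨j, ⟨Z, hZm, hZδ, hZ⟩, hdisj, hrest, hbase, heqA₀, heq, hM⟩ :=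
    ((hT.eventually_exists_exceptional S.measurePreserving (asympFixed_of_mem_weaklyHomoclinic hS)
      (𝒜 ∪ 𝒜₀) hall hδ).and (hDdisj.and ((hDrest δ hδ).and
      ((hT.tendsto_measureReal_base.eventually_lt_const
        (show (0 : ℝ) < δ / (2 * κ) by positivity)).and
      ((hT.eventually_equidistributed hDm hDdisj hDrest hA₀m hA₀D hδ).and
      (((Finset.eventually_all 𝒜).2 fun A hA => hT.eventually_equidistributed hDm hDdisj hDrest
        ((h𝒜 A hA).diff hDm) Set.disjoint_sdiff_left hδ).and
      (hT.tendsto.eventually_ge_atTop (M * (2 * κ))))))))).exists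
  have hE := hT.tower j
  set q := h j / (2 * κ) with hq
  have hqK : 2 * κ * q ≤ h j := Nat.mul_div_le _ _
  have hqK' : h j ≤ 2 * κ * q + 2 * κ := by
    have := Nat.lt_mul_div_succ (h j) (show 0 < 2 * κ by omega)
    rw [mul_add, mul_one] at this
    exact this.le
  have hMq : M ≤ q := (Nat.le_div_iff_mul_le (by omega)).2 hM
  have hqh : q ≤ h j := Nat.div_le_self _ _
  have hE0 : 0 ≤ μ.real (E j) := measureReal_nonneg
  have hhE := mul_measureReal_base_le_one hE
  have hκE : 2 * (κ : ℝ) * μ.real (E j) ≤ δ := by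
    rw [lt_div_iff₀ (by positivity)] at hbase
    linarith
  have hqE1 : 2 * (κ : ℝ) * (q * μ.real (E j)) ≤ 1 := by
    have : ((2 * κ * q : ℕ) : ℝ) * μ.real (E j) ≤ h j * μ.real (E j) := by gcongr
    push_cast at this
    linarith
  have hqE2 : Y - 2 * δ ≤ 2 * (κ : ℝ) * (q * μ.real (E j)) := by
    have h1 : (h j : ℝ) * μ.real (E j) ≤ ((2 * κ * q + 2 * κ : ℕ) : ℝ) * μ.real (E j) := by
      gcongr
    push_cast at h1
    have h2 : Y ≤ h j * μ.real (E j) + δ := by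
      have hs := measureReal_strip hE (u := 0) le_rfl
      rw [Nat.sub_zero] at hs
      rw [← hs]
      refine le_trans (measureReal_mono ?_ (measure_ne_top _ _))
        ((measureReal_union_le (strip T.toEquiv (E j) 0 (h j))
          (strip T.toEquiv (E j) 0 (h j) ∪ D)ᶜ).trans (by linarith))
      intro x hx
      simp only [Set.mem_union, Set.mem_compl_iff] at hx ⊢
      tauto
    linarith
  set β := (q : ℝ) * μ.real (E j) with hβ
  let J := (strip T.toEquiv (E j) 0 (2 * κ * q) ∪ D)ᶜ
  have hJm : MeasurableSet J :=
    ((T.measurableSet_strip hE.measurableSet 0 (2 * κ * q)).union hDm).compl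
  have hJ : μ.real J ≤ 2 * δ := by
    have hsub : J ⊆ (strip T.toEquiv (E j) 0 (h j) ∪ D)ᶜ ∪
        strip T.toEquiv (E j) (2 * κ * q) (h j) := by
      intro x hx
      simp only [J, Set.mem_compl_iff, Set.mem_union, not_or] at hx ⊢
      by_cases hxs : x ∈ strip T.toEquiv (E j) 0 (h j)
      · right
        obtain ⟨i, -, hi, hxi⟩ := mem_strip.1 hxs
        exact mem_strip.2 ⟨i, not_lt.1 fun hlt =>
          hx.1 (mem_strip.2 ⟨i, Nat.zero_le _, hlt, hxi⟩), hi, hxi⟩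
      · exact Or.inl ⟨hxs, hx.2⟩
    refine (measureReal_mono hsub (measure_ne_top _ _)).trans ((measureReal_union_le _ _).trans ?_)
    rw [measureReal_strip hE le_rfl]
    have : ((h j - 2 * κ * q : ℕ) : ℝ) ≤ 2 * κ := by
      have : h j - 2 * κ * q ≤ 2 * κ := by omega
      exact_mod_cast this
    have := mul_le_mul_of_nonneg_right this hE0
    linarith
  -- By equidistribution the moved points fill about αβ/Y of the bottom strip. The position of Sy is
  -- checked only at multiples of q, so the 2κ + 1 bad sets have total measure of order κδ, which
  -- 100κ²δ ≤ α² makes smaller.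
  have hexc : μ.real (Z ∪ ⋃ p ∈ Finset.range (2 * κ + 1),
      S.toEquiv ⁻¹' (T.toEquiv^[p * q] ⁻¹' J)) < μ.real (A₀ ∩ strip T.toEquiv (E j) 0 q) := by
    have h1 : μ.real (⋃ p ∈ Finset.range (2 * κ + 1),
        S.toEquiv ⁻¹' (T.toEquiv^[p * q] ⁻¹' J)) ≤ (2 * κ + 1) * (2 * δ) := by
      refine (measureReal_biUnion_finset_le _ _).trans ((Finset.sum_le_sum fun p _ =>
        (?_ : _ ≤ 2 * δ)).trans_eq (by simp))
      rw [S.measurePreserving.measureReal_preimage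
        (T.measurableSet_preimage_iterate _ hJm).nullMeasurableSet,
        T.measureReal_preimage_iterate _ hJm]
      exact hJ
    have h2 := heqA₀ 0 q hqh
    rw [measureReal_strip hE hqh, Nat.sub_zero, abs_le] at h2
    have h3 : μ.real (A₀ ∩ strip T.toEquiv (E j) 0 q) * Y ≤
        μ.real (A₀ ∩ strip T.toEquiv (E j) 0 q) := mul_le_of_le_one_right measureReal_nonneg hY1
    refine (measureReal_union_le _ _).trans_lt ?_
    have h4 : δ + (2 * κ + 1) * (2 * δ) < α * β - δ := by
      have h5 : α * (α - 2 * δ) ≤ 2 * κ * (α * β) := by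
        linarith [mul_le_mul_of_nonneg_left (show α - 2 * δ ≤ 2 * κ * β by linarith) hα.le]
      have h6 : 2 * κ * (δ * (4 * κ + 4)) < α * (α - 2 * δ) := by
        have e1 : κ * δ ≤ κ ^ 2 * δ := by
          rw [pow_two]
          have : (κ : ℝ) ≤ κ * κ := by nlinarith
          gcongr
        have e2 : δ ≤ κ * δ := by nlinarith
        have e3 : α * δ ≤ δ := mul_le_of_le_one_left hδ.le hα1
        linarith
      have : 2 * κ * (δ * (4 * κ + 4)) < 2 * κ * (α * β) := h6.trans_le h5
      have := lt_of_mul_lt_mul_left this (by positivity)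
      linarith
    linarith [h2.1]
  obtain ⟨y, hy, hyexc⟩ : ∃ y ∈ A₀ ∩ strip T.toEquiv (E j) 0 q,
      y ∉ Z ∪ ⋃ p ∈ Finset.range (2 * κ + 1), S.toEquiv ⁻¹' (T.toEquiv^[p * q] ⁻¹' J) := by
    by_contra! hcon
    exact hexc.not_ge (measureReal_mono hcon (measure_ne_top _ _))
  simp only [Set.mem_union, Set.mem_iUnion, not_or, not_exists] at hyexc
  have hSyD : S.toEquiv y ∉ D := fun hmem =>
    hy.1 (S.toEquiv.injective (hDfix S _ hmem))
  have hclimb : ∀ p ≤ 2 * κ,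
      T.toEquiv^[p * q] (S.toEquiv y) ∈ strip T.toEquiv (E j) 0 (2 * κ * q) := by
    intro p hp
    have h1 := hyexc.2 p (Finset.mem_range.2 (by omega))
    have h2 : T.toEquiv^[p * q] (S.toEquiv y) ∉ D := by
      intro hmem
      have hfix := Function.iterate_fixed (hDfix T _ hmem) (p * q)
      rw [T.toEquiv.injective.iterate (p * q) hfix] at hmem
      exact hSyD hmem
    simp only [J, Set.mem_preimage, Set.mem_compl_iff, Set.mem_union] at h1
    tauto
  obtain ⟨hsep, hperZ⟩ := hZ y hyexc.1
  obtain ⟨n, a, b, hn, hya, hyb, hab, hmin, hdist⟩ := exists_time_of_strip T.toEquiv.injective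
    hE.disjoint hqK hy.2 hclimb (hsep hy.1)
  have hperA := hperZ n hn a b hya hyb
  have hk0 : 0 < max a b - min a b := by omega
  have hmin' : min a b + 1 ≤ q := hmin
  generalize max a b - min a b = k at *
  generalize min a b + 1 = u at *
  have hqE1' : 2 * β ≤ 1 / κ := by
    rw [le_div_iff₀ hκ0]
    linarith
  -- A distance 0 < k < q would make k an approximate period of 𝒜₀ on the whole space.
  have hqk : q ≤ k := by
    by_contra! hkq
    obtain ⟨A, hA, hAk⟩ := hnp k hk0
    have h1 := hperA A (Finset.mem_union_right _ hA)
    have h2 := measureReal_symmDiff_preimage_le_of_strip hE (hDfix T) A hmin' hkq.le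
    linarith
  refine ⟨k, hMq.trans hqk, fun A hA => ?_⟩
  have hAm := h𝒜 A hA
  have hκq : (κ - 1) * q ≤ h j - k := by
    obtain ⟨c, rfl⟩ : ∃ c, κ = c + 1 := ⟨κ - 1, by omega⟩
    rw [Nat.add_sub_cancel]
    have e1 : 2 * (c + 1) * q = c * q + (c + 1 + 1) * q := by ring
    omega
  -- Since k ≤ (κ + 1)q and 2κq ≤ h, this strip lies inside the region of almost T^k-invariance.
  set W := strip T.toEquiv (E j) q ((κ - 1) * q)
  have hWm : MeasurableSet W := T.measurableSet_strip hE.measurableSet _ _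
  have hWh : (κ - 1) * q ≤ h j := hκq.trans (Nat.sub_le _ _)
  have hWμ : μ.real W = (κ - 2) * β := by
    rw [measureReal_strip hE hWh, hβ, ← mul_assoc]
    congr 1
    obtain ⟨c, rfl⟩ : ∃ c, κ = c + 2 := by
      have : 3 < κ := by exact_mod_cast hκ3
      exact ⟨κ - 2, by omega⟩
    rw [show (c + 2 - 1) * q - q = c * q by rw [show c + 2 - 1 = c + 1 by omega, Nat.succ_mul]; omega]
    push_cast
    ring
  -- The part of A in D returns completely, so only A \ D needs the factor one half.
  have hsplit : μ.real (A ∩ D) + μ.real ((A \ D) ∩ W) ≤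
      μ.real (A ∩ T.toEquiv^[k] ⁻¹' A) + δ := by
    rw [← measureReal_union (Set.disjoint_left.2 fun x hx hx' => hx'.1.2 hx.2)
      ((hAm.diff hDm).inter hWm)]
    refine le_trans (measureReal_mono ?_ (measure_ne_top _ _)) ((measureReal_union_le
      (A ∩ T.toEquiv^[k] ⁻¹' A) (strip T.toEquiv (E j) u (h j - k) ∩
        (A ∆ (T.toEquiv^[k] ⁻¹' A)))).trans
      (add_le_add_right (hperA A (Finset.mem_union_left _ hA)) _))
    rintro x (⟨hxA, hxD⟩ | ⟨⟨hxA, -⟩, hxW⟩)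
    · left
      refine ⟨hxA, ?_⟩
      rw [Set.mem_preimage, Function.iterate_fixed (hDfix T x hxD)]
      exact hxA
    · by_cases hx' : x ∈ T.toEquiv^[k] ⁻¹' A
      · exact Or.inl ⟨hxA, hx'⟩
      · exact Or.inr ⟨strip_mono hmin' hκq hxW, Or.inl ⟨hxA, hx'⟩⟩
  have hAsplit := measureReal_inter_add_sdiff (μ := μ) (s := A) hDm
  have hAeq := heq A hA q ((κ - 1) * q) hWh
  rw [abs_le, hWμ] at hAeq
  have ha0 : 0 ≤ μ.real (A \ D) := measureReal_nonneg
  have ha1 : μ.real (A \ D) ≤ 1 := measureReal_le_one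
  have hAD0 : 0 ≤ μ.real (A ∩ D) := measureReal_nonneg
  set s := μ.real (A \ D)
  set w := μ.real ((A \ D) ∩ W)
  have hw : s / 2 - 3 * (ε / 4) ≤ w :=
    half_sub_le_of_mul_le hκ0 (by linarith) hκε hqE2 (by linarith [hAeq.1]) ha0 ha1 hY0
      (hδε.trans (by gcongr)) hδ
  have hδ4 : δ ≤ ε / 4 := by linarith [mul_le_of_le_one_left hε.le hα1]
  linarith

end NontrivialHomoclinic

end ErgodicWH

theorem mainTheorem5 {X : Type*} [MeasurableSpace X] [StandardBorelSpace X]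
    (μ : Measure X) [IsProbabilityMeasure μ] (T : ErgodicWH.Automorphism μ)
    (hT : T.IsRankOne) :
    ((∃ S ∈ ErgodicWH.weaklyHomoclinic T, S.IsAperiodic) → T.IsRigid) ∧
    ((∃ S ∈ ErgodicWH.weaklyHomoclinic T, ¬ S.IsTrivial) → T.IsPartiallyRigid (1 / 2)) := by
  rcases hT.approxPeriodic_or with hper | ⟨E, h, hseq⟩
  · exact ⟨fun _ => hper.isRigid, fun _ => hper.halfReturning.isPartiallyRigid⟩
  · exact ⟨fun ⟨_, hS, hap⟩ => (hseq.approxPeriodic_of_isAperiodic hS hap).isRigid,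
      fun ⟨_, hS, hne⟩ => (hseq.halfReturning_of_not_isTrivial hS hne).isPartiallyRigid⟩
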